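/- Let $k\ge 0$, $d\ge 1$ and $n\ge k+1$ be integers, and fix inputs $X^1,\dots,X^n\in\mathbb{R}^d$ such that for each $j=1,\dots,d$ the numbers $X_j^1,\dots,X_j^n$ are distinct. Write $X_j=(X_j^1,\dots,X_j^n)$, let $S_j$ be the permutation matrix that sorts $X_j$ into increasing order, and let $X_j^{(1)}<\dots<X_j^{(n)}$ be the sorted values. For $t^1<\dots<t^n$ let $D^{(t,1)}\in\mathbb{R}^{(n-1)\times n}$ be the first difference matrix, $(D^{(t,1)}\theta)_i=\theta^{i+1}-\theta^i$, and, for $q\ge1$, let $D^{(t,q+1)}=D^{(1)}\,\mathrm{diag}\big(\tfrac{q}{t^{q+1}-t^1},\dots,\tfrac{q}{t^n-t^{n-q}}\big)D^{(t,q)}\in\mathbb{R}^{(n-q-1)\times n}$, where $D^{(1)}$ is the $(n-q-1)\times(n-q)$ first difference matrix. Put $D_j=D^{(t,k+1)}$ with $t=S_jX_j$. For $Y\in\mathbb{R}^n$ with mean $\bar Y$ and $\lambda\ge 0$, the additive trend filtering estimate $\hat\theta=(\hat\theta_1,\dots,\hat\theta_d)$ is a solution of $$\min_{\theta_1,\dots,\theta_d\in\mathbb{R}^n}\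 \tfrac12\Big\|Y-\bar Y\mathbf 1-\sum_{j=1}^d\theta_j\Big\|_2^2+\lambda\sum_{j=1}^d\|D_jS_j\theta_j\|_1\quad\text{subject to }\ \mathbf 1^T\theta_j=0,\ j=1,\dots,d.$$ The number of knots of $\hat\theta_j$ is the number of nonzero entries of $D_jS_j\hat\theta_j$. For each $j$ let $h_1,\dots,h_n$ be the falling factorial basis over $t=S_jX_j$: $h_i(\tau)=\prod_{\ell=1}^{i-1}(\tau-t^\ell)$ for $i\le k+1$ and $h_{i+k+1}(\tau)=\prod_{\ell=1}^{k}(\tau-t^{i+\ell})\cdot 1\{\tau>t^{i+k}\}$ for $1\le i\le n-k-1$. Let $\tilde P_j\in\mathbb{R}^{n\times k}$ and $K_j\in\mathbb{R}^{n\times(n-k-1)}$ contain the evaluations at $X_j^1,\dots,X_j^n$ of $h_2,\dots,h_{k+1}$ and of $h_{k+2},\dots,h_n$, respectively. Let $M=I-\mathbf 1\mathbf 1^T/n$ and $\tilde P=M[\tilde P_1\ \cdots\ \tilde P_d]\in\mathbb{R}^{n\times kd}$. Let $U\in\mathbb{R}^{n\times(n-kd-1)}$ have orthonormal columns that span the orthogonal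 complement of $\mathrm{span}(\mathbf 1)+\mathrm{col}(\tilde P)$, and let $\tilde K=U^TM[K_1\ \cdots\ K_d]\in\mathbb{R}^{(n-kd-1)\times(n-k-1)d}$. Assume that $\tilde P$ has full column rank and that $\tilde K$ has columns in general position; a matrix $A\in\mathbb{R}^{m\times p}$ has columns in general position if, for every $\ell<\min\{m,p\}$, all distinct column indices $i_1,\dots,i_{\ell+1}$ and all signs $s_1,\dots,s_{\ell+1}\in\{-1,1\}$, the affine span of $s_1A_{i_1},\dots,s_{\ell+1}A_{i_{\ell+1}}$ contains no element of $\{\pm A_i: i\ne i_1,\dots,i_{\ell+1}\}$. Let $\lambda\ge0$ be fixed, with $\lambda>0$ if $d\ge2$. Let $Y\sim N(\eta,\sigma^2I)$ with $\eta\in\mathbb{R}^n$ and $\sigma>0$. Then for every value of the response vector the problem has exactly one solution $\hat\theta$, the additive fit $\sum_j\hat\theta_j(Y)$ is square integrable, the number of knots is an integrable random variable, and the degrees of freedom $\mathrm{df}(\hat\eta)=\frac1{\sigma^2}\sum_{i=1}^n\mathrm{Cov}(\hat\eta^i(Y),Y^i)$ of the fit $\hat\eta=\sum_{j=1}^d\hat\theta_j$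 satisfy $$\mathrm{df}\Big(\sum_{j=1}^d\hat\theta_j\Big)=\mathbb{E}\Big(\sum_{j=1}^d(\text{number of knots in }\hat\theta_j)\Big)+kd.$$ -/

import Mathlib

open MeasureTheory ProbabilityTheory

namespace AdditiveTF

/-- The sorted version of `x`: for `x` with distinct entries, `sorted x` lists the entries of `x`
in strictly increasing order. -/
noncomputable def sorted {n : ℕ} (x : Fin n → ℝ) : Fin n → ℝ := fun i => x (Tuple.sort x i)

/-- The permutation `S` that sorts `x`, applied to a vector `θ`. -/
noncomputable def sortBy {n : ℕ} (x θ : Fin n → ℝ) : Fin n → ℝ := fun i => θ (Tuple.sort x i)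

/-- The first order difference operator, an `(m - 1) × m` matrix with rows `(…, -1, 1, …)`. -/
def diff1 (m : ℕ) : Matrix (Fin (m - 1)) (Fin m) ℝ :=
  Matrix.of fun i j => if j.val = i.val then -1 else if j.val = i.val + 1 then 1 else 0

/-- `diffOp t k` is the difference operator `D^(t, k+1)` of order `k + 1` over the increasing
input points `t`, an `(n - k - 1) × n` matrix:
`D^(t, k+2) = D^(1) * diag ((k+1) / (t_{i+k+1} - t_i)) * D^(t, k+1)`. -/
noncomputable def diffOp {n : ℕ} (t : Fin n → ℝ) :
    (k : ℕ) → Matrix (Fin (n - (k + 1))) (Fin n) ℝ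
  | 0 => diff1 n
  | k + 1 =>
    diff1 (n - (k + 1)) *
      Matrix.diagonal (fun i : Fin (n - (k + 1)) =>
        ((k : ℝ) + 1) /
          (t ⟨i.val + (k + 1), by have := i.isLt; omega⟩ - t ⟨i.val, by have := i.isLt; omega⟩)) *
      diffOp t k

/-- The discrete `(k+1)`st derivatives `D^(X_j, k+1) S_j θ_j` of one component `θ`, over the
inputs `x`. -/
noncomputable def discreteDeriv {n : ℕ} (x : Fin n → ℝ) (k : ℕ) (θ : Fin n → ℝ) :
    Fin (n - (k + 1)) → ℝ :=
  (diffOp (sorted x) k).mulVec (sortBy x θ)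

/-- The number of knots of a component `θ` over the inputs `x`: the number of nonzero discrete
`(k+1)`st derivatives. -/
noncomputable def numKnots {n : ℕ} (x : Fin n → ℝ) (k : ℕ) (θ : Fin n → ℝ) : ℕ :=
  {l : Fin (n - (k + 1)) | discreteDeriv x k θ l ≠ 0}.ncard

/-- The sample mean of `y`. -/
noncomputable def mean {n : ℕ} (y : Fin n → ℝ) : ℝ := (∑ i, y i) / n

/-- The additive trend filtering criterion at `θ = (θ_1, …, θ_d)`. The inputs are the rows of `X`,
so that `fun i => X i j` holds the `j`th coordinates of the inputs. -/
noncomputable def criterion {n d : ℕ} (X : Matrix (Fin n) (Fin d) ℝ) (k : ℕ) (lam : ℝ)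
    (y : Fin n → ℝ) (θ : Fin d → Fin n → ℝ) : ℝ :=
  (1 / 2) * ∑ i, (y i - mean y - ∑ j, θ j i) ^ 2 +
    lam * ∑ j, ∑ l, |discreteDeriv (fun i => X i j) k (θ j) l|

/-- `θ` is a solution of the additive trend filtering problem: it minimizes the criterion over all
`(θ_1, …, θ_d)` whose components each sum to zero. -/
def IsSolution {n d : ℕ} (X : Matrix (Fin n) (Fin d) ℝ) (k : ℕ) (lam : ℝ)
    (y : Fin n → ℝ) (θ : Fin d → Fin n → ℝ) : Prop :=
  (∀ j, ∑ i, θ j i = 0) ∧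
    ∀ θ' : Fin d → Fin n → ℝ, (∀ j, ∑ i, θ' j i = 0) →
      criterion X k lam y θ ≤ criterion X k lam y θ'

/-- The `k`th order falling factorial basis functions over increasing knot points `t`, indexed from
zero: the first `k + 1` are polynomials, the last `n - k - 1` are knot-producing functions. -/
noncomputable def ffBasis {n : ℕ} (t : Fin n → ℝ) (k : ℕ) (i : Fin n) (τ : ℝ) : ℝ :=
  if i.val ≤ k then
    ∏ l : Fin n with l.val < i.val, (τ - t l)
  else
    (∏ l : Fin n with l.val < i.val ∧ i.val ≤ l.val + k, (τ - t l)) *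
      (if t ⟨i.val - 1, by have := i.isLt; omega⟩ < τ then 1 else 0)

/-- The falling factorial basis matrix `H^(x, k)`: its rows follow the order of `x`, its columns
follow the order of the sorted inputs. -/
noncomputable def ffMatrix {n : ℕ} (x : Fin n → ℝ) (k : ℕ) : Matrix (Fin n) (Fin n) ℝ :=
  Matrix.of fun i l => ffBasis (sorted x) k l (x i)

/-- The first `k + 1` columns of `H^(x, k)` without the very first one (which is constant). -/
noncomputable def polyMatrix {n : ℕ} (x : Fin n → ℝ) (k : ℕ) (hk : k < n) :
    Matrix (Fin n) (Fin k) ℝ :=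
  Matrix.of fun i m => ffMatrix x k i ⟨m.val + 1, by have := m.isLt; omega⟩

/-- The last `n - k - 1` columns of `H^(x, k)`. -/
noncomputable def knotMatrix {n : ℕ} (x : Fin n → ℝ) (k : ℕ) :
    Matrix (Fin n) (Fin (n - (k + 1))) ℝ :=
  Matrix.of fun i l => ffMatrix x k i ⟨l.val + (k + 1), by have := l.isLt; omega⟩

/-- The centering matrix `M = I - 1 1ᵀ / n`. -/
noncomputable def centering (n : ℕ) : Matrix (Fin n) (Fin n) ℝ :=
  1 - Matrix.of fun _ _ => 1 / (n : ℝ)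

/-- `P̃`: the centering matrix times the columnwise concatenation of the `polyMatrix` of all `d`
input dimensions. -/
noncomputable def Ptilde {n d : ℕ} (X : Matrix (Fin n) (Fin d) ℝ) (k : ℕ) (hk : k < n) :
    Matrix (Fin n) (Fin d × Fin k) ℝ :=
  centering n * Matrix.of fun i c => polyMatrix (fun i' => X i' c.1) k hk i c.2

/-- `K̃`: `Uᵀ M` times the columnwise concatenation of the `knotMatrix` of all `d` input
dimensions. -/
noncomputable def Ktilde {n d m : ℕ} (X : Matrix (Fin n) (Fin d) ℝ) (k : ℕ)
    (U : Matrix (Fin n) (Fin m) ℝ) : Matrix (Fin m) (Fin d × Fin (n - (k + 1))) ℝ :=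
  U.transpose * centering n * Matrix.of fun i c => knotMatrix (fun i' => X i' c.1) k i c.2

/-- The columns of `U` are an orthonormal basis of the space of those vectors with mean zero that
are orthogonal to the column span of `A`. -/
def IsOrthonormalComplement {n m : ℕ} {ι : Type*} (A : Matrix (Fin n) ι ℝ)
    (U : Matrix (Fin n) (Fin m) ℝ) : Prop :=
  U.transpose * U = 1 ∧
    ∀ v : Fin n → ℝ, (∃ w, U.mulVec w = v) ↔ (∑ i, v i = 0 ∧ ∀ c, ∑ i, A i c * v i = 0)

/-- A real matrix has columns in general position: for every `ℓ < min (#rows) (#columns)`, the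
affine span of any `ℓ + 1` columns with arbitrary signs contains no other column, with either
sign. -/
def GeneralPosition {μ ι : Type*} [Fintype μ] [Fintype ι] (A : Matrix μ ι ℝ) : Prop :=
  ∀ ℓ : ℕ, ℓ < min (Fintype.card μ) (Fintype.card ι) →
    ∀ T : Finset ι, T.card = ℓ + 1 →
      ∀ s : ι → ℝ, (∀ c, s c = 1 ∨ s c = -1) →
        ∀ c, c ∉ T →
          A.col c ∉ affineSpan ℝ ((fun c' => s c' • A.col c') '' (T : Set ι)) ∧
          -A.col c ∉ affineSpan ℝ ((fun c' => s c' • A.col c') '' (T : Set ι))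

/-- The effective degrees of freedom of an estimator `g`, given data `Y` with covariance `σ² I`. -/
noncomputable def degreesOfFreedom {Ω : Type*} [MeasurableSpace Ω] (μ : Measure Ω) {n : ℕ}
    (Y : Ω → Fin n → ℝ) (σ : ℝ) (g : (Fin n → ℝ) → Fin n → ℝ) : ℝ :=
  (1 / σ ^ 2) * ∑ i, covariance (fun ω => g (Y ω) i) (fun ω => Y ω i) μ

end AdditiveTF

/-!
The coefficients of the components in the centered falling factorial basis turn additive trend
filtering into a lasso. Sorted by the inputs, the basis matrix is lower triangular with nonzero
diagonal, so mean-zero components and coefficient vectors correspond (`exists_component_eq`,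
`eq_zero_of_component_eq_zero`). The discrete derivatives of order `k + 1` are increments of divided
differences, which annihilate the polynomial columns and read off the knot coefficients up to the
factor `k !` (`discreteDeriv_component`). The result is a lasso in which polynomial coefficients
have penalty weight zero and knot coefficients have weight `lam * k !`.

General position of the projected knot columns makes the columns of every equicorrelation set
linearly independent (`nondegenerate_design`). Hence the lasso solution is unique, and the fit is a
nonexpansive function of the response. The responses with a given sign pattern of the solution form
a convex set, and the frontier of a convex set is null, so almost every response is interior to the
set of its own pattern. There the fit moves by the orthogonal projection onto the span of the active
columns, whose trace is the number of active columns (`ae_fit_eventuallyEq`). An unpenalized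
coefficient cannot vanish on such an open set, so the active columns are all `k * d` polynomial
columns and one for each knot.

Stein's identity equates the degrees of freedom with the mean of that trace. For a coordinate `f` of
the fit, differentiate `t ↦ 𝔼 f(Y + t eᵢ)` at zero in two ways: under the expectation, by the
Lipschitz bound and differentiability almost everywhere, and after moving the shift into the
Gaussian density (`integral_deriv_pi_gaussianReal`).
-/

namespace AdditiveTF

open Matrix Filter Topology
open scoped NNReal ENNReal

/-! ### The lasso with coordinatewise weights -/

section Lasso

variable {ν κ : Type*} {W : Matrix ν κ ℝ} {w : κ → ℝ}

/-- The lasso objective with design `W`, in which the coefficient `c` carries the penalty weight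
`w c`. The weight may be zero, so unpenalized coefficients need no separate treatment. -/
noncomputable def lassoObj [Fintype ν] [Fintype κ] (W : Matrix ν κ ℝ) (w : κ → ℝ)
    (y : ν → ℝ) (b : κ → ℝ) : ℝ :=
  (1 / 2) * ∑ i, (y i - (W *ᵥ b) i) ^ 2 + ∑ c, w c * |b c|

/-- The Karush-Kuhn-Tucker conditions of the weighted lasso for the coefficients `b` and the
residual `r`: the correlation of `r` with the column `c` is at most `w c` in absolute value, and
equal to `w c * sign (b c)` when `b c ≠ 0`. -/
def Stationary [Fintype ν] (W : Matrix ν κ ℝ) (w : κ → ℝ) (b : κ → ℝ) (r : ν → ℝ) : Prop :=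
  ∀ c, |(r ᵥ* W) c| ≤ w c ∧ b c * (r ᵥ* W) c = w c * |b c|

/-- For every dual feasible residual, the columns whose dual constraint is tight (the
equicorrelation set) are linearly independent. -/
def Nondegenerate [Fintype ν] (W : Matrix ν κ ℝ) (w : κ → ℝ) : Prop :=
  ∀ r : ν → ℝ, (∀ c, |(r ᵥ* W) c| ≤ w c) → LinearIndepOn ℝ W.col {c | |(r ᵥ* W) c| = w c}

lemma eq_zero_of_linearIndepOn [Fintype κ] {S : Set κ} (h : LinearIndepOn ℝ W.col S) {b : κ → ℝ}
    (hb : ∀ c, c ∉ S → b c = 0) (h0 : W *ᵥ b = 0) : b = 0 := by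
  classical
  rw [linearIndepOn_iff'] at h
  have key := h (Finset.univ.filter (· ∈ S)) b (by intro c; simp) (by
    rw [Finset.sum_filter_of_ne]
    · rw [← h0]
      ext i
      simp [Matrix.mulVec, dotProduct, Finset.sum_apply, mul_comm]
    · intro c _ hc
      by_contra hcS
      exact hc (by rw [hb c hcS, zero_smul]))
  ext c
  by_cases hc : c ∈ S
  · exact key c (by simpa using hc)
  · exact hb c hc

variable [Fintype ν]

lemma Stationary.abs_eq {b : κ → ℝ} {r : ν → ℝ} (h : Stationary W w b r) {c : κ}
    (hc : b c ≠ 0) : |(r ᵥ* W) c| = w c := by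
  have h1 := congrArg abs (h c).2
  have hw : 0 ≤ w c := (abs_nonneg _).trans (h c).1
  rw [abs_mul, abs_mul, abs_abs, abs_of_nonneg hw, mul_comm] at h1
  exact mul_right_cancel₀ (abs_ne_zero.2 hc) h1

variable [Fintype κ]

lemma Stationary.monotone {b b' : κ → ℝ} {r r' : ν → ℝ} (h : Stationary W w b r)
    (h' : Stationary W w b' r') : 0 ≤ (r - r') ⬝ᵥ (W *ᵥ b - W *ᵥ b') := by
  rw [← Matrix.mulVec_sub, dotProduct_mulVec, Matrix.sub_vecMul]
  refine Finset.sum_nonneg fun c _ => ?_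
  simp only [Pi.sub_apply]
  have h1 := (h c).2
  have h2 := (h' c).2
  have h3 : b c * (r' ᵥ* W) c ≤ w c * |b c| := by
    refine (le_abs_self _).trans ?_
    rw [abs_mul, mul_comm]
    exact mul_le_mul_of_nonneg_right (h' c).1 (abs_nonneg _)
  have h4 : b' c * (r ᵥ* W) c ≤ w c * |b' c| := by
    refine (le_abs_self _).trans ?_
    rw [abs_mul, mul_comm]
    exact mul_le_mul_of_nonneg_right (h c).1 (abs_nonneg _)
  nlinarith

/-- The fit is a nonexpansive function of the response. -/
lemma Stationary.nonexpansive {b b' : κ → ℝ} {r r' : ν → ℝ} (h : Stationary W w b r)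
    (h' : Stationary W w b' r') :
    ∑ i, ((W *ᵥ b) i - (W *ᵥ b') i) ^ 2 ≤
      ∑ i, (((W *ᵥ b) i + r i) - ((W *ᵥ b') i + r' i)) ^ 2 := by
  have hm := h.monotone h'
  simp only [dotProduct, Pi.sub_apply] at hm
  have : ∑ i, (((W *ᵥ b) i + r i) - ((W *ᵥ b') i + r' i)) ^ 2 =
      ∑ i, ((W *ᵥ b) i - (W *ᵥ b') i) ^ 2 +
        2 * ∑ i, (r i - r' i) * ((W *ᵥ b) i - (W *ᵥ b') i) + ∑ i, (r i - r' i) ^ 2 := by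
    rw [Finset.mul_sum, ← Finset.sum_add_distrib, ← Finset.sum_add_distrib]
    exact Finset.sum_congr rfl fun i _ => by ring
  have h3 : 0 ≤ ∑ i, (r i - r' i) ^ 2 := Finset.sum_nonneg fun i _ => sq_nonneg _
  linarith

lemma Nondegenerate.stationary_unique (hW : Nondegenerate W w) {y : ν → ℝ} {b b' : κ → ℝ}
    (h : Stationary W w b (y - W *ᵥ b)) (h' : Stationary W w b' (y - W *ᵥ b')) : b = b' := by
  have hne := h.nonexpansive h'
  have h0 : W *ᵥ b = W *ᵥ b' := by
    have hz : ∑ i, ((W *ᵥ b) i - (W *ᵥ b') i) ^ 2 = 0 := by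
      refine le_antisymm (hne.trans_eq ?_) (Finset.sum_nonneg fun i _ => sq_nonneg _)
      simp
    rw [Finset.sum_eq_zero_iff_of_nonneg fun i _ => sq_nonneg _] at hz
    ext i
    exact sub_eq_zero.1 (pow_eq_zero_iff two_ne_zero |>.1 (hz i (Finset.mem_univ i)))
  rw [← h0] at h'
  refine sub_eq_zero.1 (eq_zero_of_linearIndepOn (hW _ fun c => (h c).1) (fun c hc => ?_) ?_)
  · have h1 : b c = 0 := by_contra fun hb => hc (h.abs_eq hb)
    have h2 : b' c = 0 := by_contra fun hb => hc (h'.abs_eq hb)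
    simp [h1, h2]
  · rw [Matrix.mulVec_sub, h0, sub_self]

lemma lassoObj_sub (y : ν → ℝ) (b b' : κ → ℝ) :
    lassoObj W w y b' - lassoObj W w y b =
      (1 / 2) * ∑ i, ((W *ᵥ (b' - b)) i) ^ 2 +
        ∑ c, (w c * (|b' c| - |b c|) - (b' c - b c) * ((y - W *ᵥ b) ᵥ* W) c) := by
  have h1 : ∑ c, (b' c - b c) * ((y - W *ᵥ b) ᵥ* W) c =
      ∑ i, (y i - (W *ᵥ b) i) * (W *ᵥ (b' - b)) i := by
    have := dotProduct_mulVec (y - W *ᵥ b) W (b' - b)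
    simp only [dotProduct, Pi.sub_apply] at this
    rw [this]
    exact Finset.sum_congr rfl fun c _ => mul_comm _ _
  rw [Finset.sum_sub_distrib, h1]
  simp only [mul_sub, Finset.sum_sub_distrib]
  have h2 : ∑ i, (y i - (W *ᵥ b') i) ^ 2 = ∑ i, (y i - (W *ᵥ b) i) ^ 2
      - 2 * ∑ i, (y i - (W *ᵥ b) i) * (W *ᵥ (b' - b)) i + ∑ i, ((W *ᵥ (b' - b)) i) ^ 2 := by
    rw [Finset.mul_sum, ← Finset.sum_sub_distrib, ← Finset.sum_add_distrib]
    refine Finset.sum_congr rfl fun i _ => ?_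
    rw [Matrix.mulVec_sub, Pi.sub_apply]
    ring
  unfold lassoObj
  rw [h2]
  ring

lemma Stationary.lassoObj_le {y : ν → ℝ} {b : κ → ℝ} (h : Stationary W w b (y - W *ᵥ b))
    (b' : κ → ℝ) : lassoObj W w y b ≤ lassoObj W w y b' := by
  rw [← sub_nonneg, lassoObj_sub]
  refine add_nonneg (mul_nonneg (by norm_num) (Finset.sum_nonneg fun i _ => sq_nonneg _))
    (Finset.sum_nonneg fun c _ => ?_)
  have h1 := (h c).2
  have h4 : b' c * ((y - W *ᵥ b) ᵥ* W) c ≤ w c * |b' c| := by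
    refine (le_abs_self _).trans ?_
    rw [abs_mul, mul_comm]
    exact mul_le_mul_of_nonneg_right (h c).1 (abs_nonneg _)
  nlinarith

/-- The scalar first-order condition: the one-dimensional objective with slope `-g`, curvature `q`
and penalty `u` has its minimum over all shifts of `x` at the shift zero. -/
lemma abs_le_and_mul_eq_of_forall_nonneg {g q u x : ℝ} (hu : 0 ≤ u)
    (h : ∀ t : ℝ, 0 ≤ (1 / 2) * (t ^ 2 * q) + (u * (|x + t| - |x|) - t * g)) :
    |g| ≤ u ∧ x * g = u * |x| := by
  -- The quadratic term is of higher order in the size `ε` of the shift.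
  have small : ∀ a : ℝ, (∀ ε : ℝ, 0 < ε → ε < 1 → 0 ≤ a + ε * (|q| * (1 + x ^ 2))) → 0 ≤ a := by
    intro a ha
    have hc : Tendsto (fun ε : ℝ => a + ε * (|q| * (1 + x ^ 2))) (𝓝[>] 0) (𝓝 a) := by
      have : Continuous fun ε : ℝ => a + ε * (|q| * (1 + x ^ 2)) := by fun_prop
      simpa using (this.tendsto 0).mono_left nhdsWithin_le_nhds
    refine ge_of_tendsto hc ?_
    filter_upwards [Ioo_mem_nhdsGT (zero_lt_one' ℝ)] with ε hε using ha ε hε.1 hε.2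
  have hq := le_abs_self q
  have hg : |g| ≤ u := by
    rw [abs_le']
    constructor
    · rw [← sub_nonneg]
      refine small _ fun ε h0 h1 => ?_
      have ht := h ε
      have habs : |x + ε| - |x| ≤ ε := by
        have := abs_add_le x ε
        rw [abs_of_pos h0] at this
        linarith
      have h2 := mul_le_mul_of_nonneg_left habs hu
      have h3 : 0 ≤ ε * ((u - g) + ε * (|q| * (1 + x ^ 2))) := by
        have h5 : ε ^ 2 * q ≤ ε ^ 2 * |q| := mul_le_mul_of_nonneg_left hq (sq_nonneg _)
        have h6 : 0 ≤ ε ^ 2 * |q| := by positivity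
        have h7 : 0 ≤ ε ^ 2 * |q| * x ^ 2 := by positivity
        nlinarith
      exact nonneg_of_mul_nonneg_right h3 h0
    · rw [← sub_nonneg]
      refine small _ fun ε h0 h1 => ?_
      have ht := h (-ε)
      have habs : |x + -ε| - |x| ≤ ε := by
        have := abs_add_le x (-ε)
        rw [abs_neg, abs_of_pos h0] at this
        linarith
      have h2 := mul_le_mul_of_nonneg_left habs hu
      have h3 : 0 ≤ ε * ((u - -g) + ε * (|q| * (1 + x ^ 2))) := by
        have h5 : ε ^ 2 * q ≤ ε ^ 2 * |q| := mul_le_mul_of_nonneg_left hq (sq_nonneg _)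
        have h6 : 0 ≤ ε ^ 2 * |q| := by positivity
        have h7 : 0 ≤ ε ^ 2 * |q| * x ^ 2 := by positivity
        nlinarith
      exact nonneg_of_mul_nonneg_right h3 h0
  refine ⟨hg, le_antisymm ?_ ?_⟩
  · refine (le_abs_self _).trans ?_
    rw [abs_mul, mul_comm]
    exact mul_le_mul_of_nonneg_right hg (abs_nonneg _)
  · rw [← sub_nonneg]
    refine small _ fun ε h0 h1 => ?_
    have ht := h (-ε * x)
    have habs : |x + -ε * x| = (1 - ε) * |x| := by
      rw [show x + -ε * x = (1 - ε) * x by ring, abs_mul, abs_of_pos (by linarith)]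
    rw [habs] at ht
    have h3 : 0 ≤ ε * ((x * g - u * |x|) + ε * (|q| * (1 + x ^ 2))) := by
      have h5 : ε ^ 2 * x ^ 2 * q ≤ ε ^ 2 * x ^ 2 * |q| :=
        mul_le_mul_of_nonneg_left hq (by positivity)
      have h6 : 0 ≤ ε ^ 2 * |q| := by positivity
      have h7 : 0 ≤ ε ^ 2 * |q| * x ^ 2 := by positivity
      nlinarith
    exact nonneg_of_mul_nonneg_right h3 h0

lemma stationary_of_forall_lassoObj_le (hw : ∀ c, 0 ≤ w c) {y : ν → ℝ} {b : κ → ℝ}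
    (h : ∀ b', lassoObj W w y b ≤ lassoObj W w y b') : Stationary W w b (y - W *ᵥ b) := by
  classical
  intro c
  refine abs_le_and_mul_eq_of_forall_nonneg (q := ∑ i, (W i c) ^ 2) (hw c) fun t => ?_
  have h1 := sub_nonneg.2 (h (b + Pi.single c t))
  rw [lassoObj_sub, add_sub_cancel_left, Finset.sum_eq_single c] at h1
  · have h2 : ∑ i, ((W *ᵥ Pi.single c t) i) ^ 2 = t ^ 2 * ∑ i, (W i c) ^ 2 := by
      rw [Finset.mul_sum]
      refine Finset.sum_congr rfl fun i _ => ?_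
      simp [Matrix.mulVec_single]
      ring
    rw [h2] at h1
    simpa using h1
  · intro c' _ hc
    simp [hc]
  · simp

/-- Minimizers exist because the fit and the penalty together control the coefficients: columns of
weight zero are linearly independent, by nondegeneracy at the zero residual. -/
lemma Nondegenerate.exists_forall_lassoObj_le (hW : Nondegenerate W w) (hw : ∀ c, 0 ≤ w c)
    (y : ν → ℝ) : ∃ b, ∀ b', lassoObj W w y b ≤ lassoObj W w y b' := by
  let L : (κ → ℝ) →ₗ[ℝ] (ν → ℝ) × (κ → ℝ) :=
    W.mulVecLin.prod (LinearMap.pi fun c => w c • LinearMap.proj c)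
  have hL : LinearMap.ker L = ⊥ := by
    rw [LinearMap.ker_eq_bot']
    intro b hb
    have h1 : W *ᵥ b = 0 := congrArg Prod.fst hb
    have h2 : ∀ c, w c * b c = 0 := fun c => congrFun (congrArg Prod.snd hb) c
    refine eq_zero_of_linearIndepOn (hW 0 (by simpa using hw)) (fun c hc => ?_) h1
    have : w c ≠ 0 := by
      intro h0
      exact hc (by simp [h0])
    exact (mul_eq_zero.1 (h2 c)).resolve_left this
  obtain ⟨K, -, hK⟩ := L.exists_antilipschitzWith hL
  have hcont : Continuous (lassoObj W w y) := by
    unfold lassoObj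
    fun_prop
  refine hcont.exists_forall_le_of_isBounded 0 ?_
  set R := lassoObj W w y 0 with hR
  have hR0 : 0 ≤ R := by
    simp only [hR, lassoObj, Matrix.mulVec_zero]
    have : 0 ≤ ∑ i, (y i - (0 : ν → ℝ) i) ^ 2 := Finset.sum_nonneg fun i _ => sq_nonneg _
    simpa using this
  rw [isBounded_iff_forall_norm_le]
  refine ⟨K * (‖y‖ + (2 * R + 1) + R), fun b hb => ?_⟩
  have hb' : lassoObj W w y b ≤ R := hb
  have hpen : 0 ≤ ∑ c, w c * |b c| :=
    Finset.sum_nonneg fun c _ => mul_nonneg (hw c) (abs_nonneg _)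
  have hsq : 0 ≤ ∑ i, (y i - (W *ᵥ b) i) ^ 2 := Finset.sum_nonneg fun i _ => sq_nonneg _
  unfold lassoObj at hb'
  have hbound := hK.le_mul_dist b 0
  rw [dist_zero_right, map_zero, dist_zero_right] at hbound
  refine hbound.trans (mul_le_mul_of_nonneg_left ?_ K.2)
  rw [Prod.norm_def, max_le_iff]
  constructor
  · have hres : ‖y - W *ᵥ b‖ ≤ 2 * R + 1 := by
      rw [pi_norm_le_iff_of_nonneg (by linarith)]
      intro i
      have h1 : (y i - (W *ᵥ b) i) ^ 2 ≤ ∑ i, (y i - (W *ᵥ b) i) ^ 2 :=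
        Finset.single_le_sum (f := fun i => (y i - (W *ᵥ b) i) ^ 2)
          (fun i _ => sq_nonneg _) (Finset.mem_univ i)
      rw [Pi.sub_apply, Real.norm_eq_abs]
      refine abs_le_of_sq_le_sq ?_ (by linarith)
      nlinarith
    have : (L b).1 = y - (y - W *ᵥ b) := by
      rw [sub_sub_cancel]
      rfl
    rw [this]
    exact (norm_sub_le _ _).trans (by linarith)
  · rw [pi_norm_le_iff_of_nonneg (by positivity)]
    intro c
    have h1 : w c * |b c| ≤ ∑ c, w c * |b c| :=
      Finset.single_le_sum (f := fun c => w c * |b c|)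
        (fun c _ => mul_nonneg (hw c) (abs_nonneg _)) (Finset.mem_univ c)
    have h2 : ‖(L b).2 c‖ = w c * |b c| := by
      change ‖w c * b c‖ = _
      rw [Real.norm_eq_abs, abs_mul, abs_of_nonneg (hw c)]
    rw [h2]
    have := norm_nonneg y
    linarith

end Lasso

/-! ### Local affinity of the lasso fit -/

section LocalAffinity

variable {ν κ : Type*} [Fintype ν] {W : Matrix ν κ ℝ} {w : κ → ℝ}

lemma Stationary.vecMul_eq_of_sign_eq {b b' : κ → ℝ} {r r' : ν → ℝ} (h : Stationary W w b r)
    (h' : Stationary W w b' r') {c : κ} (hs : SignType.sign (b c) = SignType.sign (b' c))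
    (hc : b c ≠ 0) : (r ᵥ* W) c = (r' ᵥ* W) c := by
  have e1 := (h c).2
  have e2 := (h' c).2
  rcases lt_or_gt_of_ne hc with hlt | hgt
  · rw [sign_neg hlt] at hs
    have hlt' := sign_eq_neg_one_iff.1 hs.symm
    rw [abs_of_neg hlt] at e1
    rw [abs_of_neg hlt'] at e2
    have e1 : (r ᵥ* W) c = -w c := mul_left_cancel₀ hlt.ne (by linarith)
    have e2 : (r' ᵥ* W) c = -w c := mul_left_cancel₀ hlt'.ne (by linarith)
    rw [e1, e2]
  · rw [sign_pos hgt] at hs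
    have hgt' := sign_eq_one_iff.1 hs.symm
    rw [abs_of_pos hgt] at e1
    rw [abs_of_pos hgt'] at e2
    have e1 : (r ᵥ* W) c = w c := mul_left_cancel₀ hgt.ne' (by linarith)
    have e2 : (r' ᵥ* W) c = w c := mul_left_cancel₀ hgt'.ne' (by linarith)
    rw [e1, e2]

/-- The matrix of the orthogonal projection onto the span of the columns of `W` indexed by `A`,
valid when these columns are linearly independent. -/
noncomputable def colProj [DecidableEq κ] (W : Matrix ν κ ℝ) (A : Finset κ) : Matrix ν ν ℝ :=
  W.submatrix id (Subtype.val : A → κ) *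
    ((W.submatrix id (Subtype.val : A → κ))ᵀ * W.submatrix id (Subtype.val : A → κ))⁻¹ *
      (W.submatrix id (Subtype.val : A → κ))ᵀ

lemma isUnit_gram [DecidableEq κ] {A : Finset κ} (hA : LinearIndepOn ℝ W.col (A : Set κ)) :
    IsUnit ((W.submatrix id (Subtype.val : A → κ))ᵀ * W.submatrix id (Subtype.val : A → κ)) := by
  set B := W.submatrix id (Subtype.val : A → κ)
  have hB : LinearIndependent ℝ B.col := hA
  rw [← Matrix.mulVec_injective_iff_isUnit]
  intro u v huv
  have h1 : (Bᵀ * B) *ᵥ (u - v) = 0 := by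
    rw [Matrix.mulVec_sub, sub_eq_zero]
    exact huv
  have h2 : B *ᵥ (u - v) = 0 := by
    rw [← dotProduct_self_eq_zero, dotProduct_mulVec, ← Matrix.mulVec_transpose,
      Matrix.mulVec_mulVec, h1, zero_dotProduct]
  exact Matrix.mulVec_injective_iff.2 hB (sub_eq_zero.1 (by rw [← Matrix.mulVec_sub, h2]))

lemma trace_colProj [DecidableEq κ] {A : Finset κ} (hA : LinearIndepOn ℝ W.col (A : Set κ)) :
    (colProj W A).trace = A.card := by
  unfold colProj
  rw [Matrix.trace_mul_comm, ← Matrix.mul_assoc,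
    Matrix.mul_nonsing_inv _ ((Matrix.isUnit_iff_isUnit_det _).1 (isUnit_gram hA)),
    Matrix.trace_one, Fintype.card_coe]

lemma mulVec_eq_colProj_mulVec [Fintype κ] [DecidableEq κ] {A : Finset κ}
    (hA : LinearIndepOn ℝ W.col (A : Set κ))
    {b : κ → ℝ} (hb : ∀ c, c ∉ A → b c = 0) {r : ν → ℝ} (hr : ∀ c ∈ A, (r ᵥ* W) c = 0) :
    W *ᵥ b = colProj W A *ᵥ (W *ᵥ b + r) := by
  set B := W.submatrix id (Subtype.val : A → κ) with hB
  have h1 : W *ᵥ b = B *ᵥ (fun c : A => b c) := by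
    ext i
    simp only [Matrix.mulVec, dotProduct, hB, Matrix.submatrix_apply, id]
    rw [Finset.sum_coe_sort A (fun c => W i c * b c)]
    exact (Finset.sum_subset (Finset.subset_univ A) fun c _ hc => by simp [hb c hc]).symm
  have h2 : Bᵀ *ᵥ r = 0 := by
    ext c
    rw [Matrix.mulVec_transpose]
    exact hr c c.2
  have hu := (Matrix.isUnit_iff_isUnit_det _).1 (isUnit_gram hA)
  rw [h1]
  unfold colProj
  rw [← hB, ← Matrix.mulVec_mulVec, Matrix.mulVec_add Bᵀ, h2, add_zero, Matrix.mulVec_mulVec _ Bᵀ B,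
    ← Matrix.mulVec_mulVec, Matrix.mulVec_mulVec _ _⁻¹, Matrix.nonsing_inv_mul _ hu,
    Matrix.one_mulVec]

variable [Fintype κ]

/-- The responses whose lasso solution has the sign pattern `s`, described as the sums of a fit and
a residual that satisfy the Karush-Kuhn-Tucker conditions. -/
def signCell (W : Matrix ν κ ℝ) (w : κ → ℝ) (s : κ → SignType) : Set (ν → ℝ) :=
  {y | ∃ b r, (∀ c, SignType.sign (b c) = s c) ∧ Stationary W w b r ∧ y = W *ᵥ b + r}

lemma convex_signCell (s : κ → SignType) : Convex ℝ (signCell W w s) := by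
  rintro _ ⟨b, r, hs, h, rfl⟩ _ ⟨b', r', hs', h', rfl⟩ α β hα hβ hαβ
  refine ⟨α • b + β • b', α • r + β • r', fun c => ?_, fun c => ?_, ?_⟩
  · have h1 := hs c
    have h2 := hs' c
    rcases hsc : s c with _ | _ | _
    · rw [hsc] at h1 h2
      have h1 := sign_eq_zero_iff.1 h1
      have h2 := sign_eq_zero_iff.1 h2
      simp [h1, h2]
    · rw [hsc] at h1 h2
      have h1 := sign_eq_neg_one_iff.1 h1
      have h2 := sign_eq_neg_one_iff.1 h2
      refine sign_eq_neg_one_iff.2 ?_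
      simp only [Pi.add_apply, Pi.smul_apply, smul_eq_mul]
      exact convex_Iio (𝕜 := ℝ) (0 : ℝ) h1 h2 hα hβ hαβ
    · rw [hsc] at h1 h2
      have h1 := sign_eq_one_iff.1 h1
      have h2 := sign_eq_one_iff.1 h2
      refine sign_eq_one_iff.2 ?_
      simp only [Pi.add_apply, Pi.smul_apply, smul_eq_mul]
      exact convex_Ioi (𝕜 := ℝ) (0 : ℝ) h1 h2 hα hβ hαβ
  · have hlin : ((α • r + β • r') ᵥ* W) c = α * (r ᵥ* W) c + β * (r' ᵥ* W) c := by
      simp [Matrix.add_vecMul, Matrix.smul_vecMul]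
    rw [hlin]
    constructor
    · rw [abs_le]
      exact convex_Icc (𝕜 := ℝ) (-w c) (w c) (abs_le.1 (h c).1) (abs_le.1 (h' c).1) hα hβ hαβ
    · have h1 := hs c
      have h2 := hs' c
      have e1 := (h c).2
      have e2 := (h' c).2
      simp only [Pi.add_apply, Pi.smul_apply, smul_eq_mul]
      rcases hsc : s c with _ | _ | _
      · rw [hsc] at h1 h2
        have h1 := sign_eq_zero_iff.1 h1
        have h2 := sign_eq_zero_iff.1 h2
        simp [h1, h2]
      · rw [hsc] at h1 h2
        have h1 := sign_eq_neg_one_iff.1 h1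
        have h2 := sign_eq_neg_one_iff.1 h2
        have h3 : α * b c + β * b' c ≤ 0 := by nlinarith
        rw [abs_of_neg h1] at e1
        rw [abs_of_neg h2] at e2
        have e1 : (r ᵥ* W) c = -w c := mul_left_cancel₀ h1.ne (by linarith)
        have e2 : (r' ᵥ* W) c = -w c := mul_left_cancel₀ h2.ne (by linarith)
        rw [abs_of_nonpos h3, e1, e2]
        linear_combination -(α * b c + β * b' c) * w c * hαβ
      · rw [hsc] at h1 h2
        have h1 := sign_eq_one_iff.1 h1
        have h2 := sign_eq_one_iff.1 h2
        have h3 : 0 ≤ α * b c + β * b' c := by positivity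
        rw [abs_of_pos h1] at e1
        rw [abs_of_pos h2] at e2
        have e1 : (r ᵥ* W) c = w c := mul_left_cancel₀ h1.ne' (by linarith)
        have e2 : (r' ᵥ* W) c = w c := mul_left_cancel₀ h2.ne' (by linarith)
        rw [abs_of_nonneg h3, e1, e2]
        linear_combination (α * b c + β * b' c) * w c * hαβ
  · rw [Matrix.mulVec_add, Matrix.mulVec_smul, Matrix.mulVec_smul, smul_add, smul_add]
    abel

/-- Almost every response lies in the interior of the cell of its sign pattern, because there are
finitely many cells and all are convex. -/
lemma ae_mem_interior_signCell {b : (ν → ℝ) → κ → ℝ}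
    (hb : ∀ y, Stationary W w (b y) (y - W *ᵥ b y)) :
    ∀ᵐ y ∂(volume : Measure (ν → ℝ)),
      y ∈ interior (signCell W w fun c => SignType.sign (b y c)) := by
  have h : ∀ᵐ y ∂(volume : Measure (ν → ℝ)), ∀ s : κ → SignType, y ∉ frontier (signCell W w s) :=
    ae_all_iff.2 fun s => measure_eq_zero_iff_ae_notMem.1 ((convex_signCell s).addHaar_frontier _)
  filter_upwards [h] with y hy
  by_contra hi
  refine hy _ ⟨subset_closure ?_, hi⟩
  exact ⟨b y, y - W *ᵥ b y, fun c => rfl, hb y, by simp⟩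

/-- At almost every response, the fit is locally the translate of a linear map whose trace is the
number of nonzero coefficients, and all unpenalized coefficients are nonzero. -/
theorem ae_fit_eventuallyEq (hW : Nondegenerate W w) {b : (ν → ℝ) → κ → ℝ}
    (hb : ∀ y, Stationary W w (b y) (y - W *ᵥ b y)) :
    ∀ᵐ y ∂(volume : Measure (ν → ℝ)),
      (∃ Q : Matrix ν ν ℝ, (∀ᶠ y' in 𝓝 y, W *ᵥ b y' - W *ᵥ b y = Q *ᵥ (y' - y)) ∧
        Q.trace = {c | b y c ≠ 0}.ncard) ∧ ∀ c, w c = 0 → b y c ≠ 0 := by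
  classical
  filter_upwards [ae_mem_interior_signCell hb] with y hy
  have hcell : ∀ᶠ y' in 𝓝 y, ∀ c, SignType.sign (b y' c) = SignType.sign (b y c) := by
    filter_upwards [mem_interior_iff_mem_nhds.1 hy] with y' hy'
    obtain ⟨b', r', hs, h, rfl⟩ := hy'
    have : b (W *ᵥ b' + r') = b' := hW.stationary_unique (hb _) (by simpa using h)
    rwa [this]
  set A : Finset κ := Finset.univ.filter fun c => b y c ≠ 0 with hAdef
  have hmem : ∀ c, c ∈ A ↔ b y c ≠ 0 := fun c => by simp [hAdef]
  have htight := hW _ fun c => (hb y c).1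
  have hA : LinearIndepOn ℝ W.col (A : Set κ) :=
    htight.mono fun c hc => (hb y).abs_eq ((hmem c).1 hc)
  have hsupp : ∀ y', (∀ c, SignType.sign (b y' c) = SignType.sign (b y c)) →
      (∀ c, c ∉ A → (b y' - b y) c = 0) ∧
        ∀ c ∈ A, (((y' - W *ᵥ b y') - (y - W *ᵥ b y)) ᵥ* W) c = 0 := by
    intro y' hs
    constructor
    · intro c hc
      have h0 : b y c = 0 := by
        by_contra h
        exact hc ((hmem c).2 h)
      have h1 := hs c
      rw [h0, sign_zero, sign_eq_zero_iff] at h1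
      simp [h0, h1]
    · intro c hc
      rw [Matrix.sub_vecMul, Pi.sub_apply, sub_eq_zero]
      exact ((hb y).vecMul_eq_of_sign_eq (hb y') (hs c).symm ((hmem c).1 hc)).symm
  refine ⟨⟨colProj W A, ?_, ?_⟩, fun c hwc hbc => ?_⟩
  · filter_upwards [hcell] with y' hs
    obtain ⟨h1, h2⟩ := hsupp y' hs
    have := mulVec_eq_colProj_mulVec hA h1 h2
    rw [Matrix.mulVec_sub] at this
    rw [this]
    congr 1
    abel
  · rw [trace_colProj hA, ← Set.ncard_coe_finset]
    congr 2
    ext c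
    simp [hAdef]
  -- Moving the response along an inactive unpenalized column `c` leaves the residual orthogonal
  -- to it, so the column would lie in the span of the active ones.
  · have htend : Tendsto (fun ε : ℝ => y + ε • W.col c) (𝓝[>] 0) (𝓝 y) := by
      have : Continuous fun ε : ℝ => y + ε • W.col c := by fun_prop
      simpa using (this.tendsto 0).mono_left nhdsWithin_le_nhds
    obtain ⟨ε, hs, hε⟩ := ((htend.eventually hcell).and self_mem_nhdsWithin).exists
    have hε : 0 < ε := hε
    set y' := y + ε • W.col c with hy'
    obtain ⟨h1, h2⟩ := hsupp y' hs
    set ρ := (y' - W *ᵥ b y') - (y - W *ᵥ b y) with hρ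
    have hcol : W *ᵥ Pi.single c ε = ε • W.col c := by
      ext i
      simp [Matrix.mulVec_single, mul_comm]
    have hρW : ρ = W *ᵥ (Pi.single c ε - (b y' - b y)) := by
      rw [Matrix.mulVec_sub, hcol, Matrix.mulVec_sub, hρ, hy']
      abel
    have hzero : ∀ y, ((y - W *ᵥ b y) ᵥ* W) c = 0 := fun y => by
      have := (hb y c).1
      rw [hwc] at this
      exact abs_nonpos_iff.1 this
    have hρ0 : ρ = 0 := by
      rw [← dotProduct_self_eq_zero]
      nth_rewrite 2 [hρW]
      rw [dotProduct_mulVec]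
      refine Finset.sum_eq_zero fun c' _ => ?_
      by_cases hc' : c' ∈ A
      · rw [h2 c' hc', zero_mul]
      by_cases hcc : c' = c
      · rw [hcc, hρ, Matrix.sub_vecMul, Pi.sub_apply, hzero, hzero, sub_zero, zero_mul]
      · rw [Pi.sub_apply, h1 c' hc', Pi.single_eq_of_ne hcc, sub_zero, mul_zero]
    have hvan := eq_zero_of_linearIndepOn htight (b := Pi.single c ε - (b y' - b y))
      (fun c' hc' => ?_) (by rw [← hρW, hρ0])
    · have := congrFun hvan c
      rw [Pi.sub_apply, h1 c (fun h => (hmem c).1 h hbc)] at this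
      simp at this
      exact hε.ne' this
    · have hcc : c' ≠ c := by
        rintro rfl
        exact hc' (by simp [hzero, hwc])
      have : c' ∉ A := fun h => hc' ((hb y).abs_eq ((hmem c').1 h))
      rw [Pi.sub_apply, h1 c' this, Pi.single_eq_of_ne hcc, sub_zero]

end LocalAffinity

/-! ### Divided differences -/

/-- The divided difference of order `q` of the values `f` over the points `t i, …, t (i + q)`.
Points and values are indexed by all natural numbers; only the listed ones matter. -/
noncomputable def divDiff (t f : ℕ → ℝ) : ℕ → ℕ → ℝ
  | 0, i => f i
  | q + 1, i => (divDiff t f q (i + 1) - divDiff t f q i) / (t (i + (q + 1)) - t i)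

lemma divDiff_congr {t f g : ℕ → ℝ} {q i : ℕ} (h : ∀ m, i ≤ m → m ≤ i + q → f m = g m) :
    divDiff t f q i = divDiff t g q i := by
  induction q generalizing i with
  | zero => exact h i le_rfl le_rfl
  | succ q ih =>
    simp only [divDiff]
    rw [ih fun m h1 h2 => h m (by omega) (by omega), ih fun m h1 h2 => h m h1 (by omega)]

lemma divDiff_zero (t : ℕ → ℝ) (q i : ℕ) : divDiff t (fun _ => 0) q i = 0 := by
  induction q generalizing i with
  | zero => rfl
  | succ q ih => simp [divDiff, ih]

/-- Leibniz rule for the product with a monic linear factor. -/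
lemma divDiff_sub_mul {n : ℕ} {t : ℕ → ℝ} (ht : ∀ i j, i < j → j < n → t i ≠ t j) (f : ℕ → ℝ)
    (a : ℝ) {q i : ℕ} (hi : i + (q + 1) < n) :
    divDiff t (fun m => (t m - a) * f m) (q + 1) i =
      (t i - a) * divDiff t f (q + 1) i + divDiff t f q (i + 1) := by
  induction q generalizing i with
  | zero =>
    have h := sub_ne_zero.2 (ht i (i + 1) (by omega) hi).symm
    simp only [divDiff, zero_add]
    field_simp
    ring
  | succ q ih =>
    have h := sub_ne_zero.2 (ht i (i + (q + 1 + 1)) (by omega) hi).symm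
    have h' := sub_ne_zero.2 (ht (i + 1) (i + 1 + (q + 1)) (by omega) (by omega)).symm
    have e : divDiff t f q (i + 1 + 1) - divDiff t f q (i + 1) =
        (t (i + 1 + (q + 1)) - t (i + 1)) * divDiff t f (q + 1) (i + 1) := by
      simp only [divDiff]
      field_simp
    rw [divDiff, ih (by omega), ih (by omega),
      show divDiff t f (q + 1 + 1) i = (divDiff t f (q + 1) (i + 1) - divDiff t f (q + 1) i) /
        (t (i + (q + 1 + 1)) - t i) from rfl]
    rw [show i + 1 + (q + 1) = i + (q + 1 + 1) by ring] at e
    field_simp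
    linear_combination e

/-- The divided difference of order `q` of a monic polynomial of degree at most `q` is its
coefficient of degree `q`. -/
lemma divDiff_prod_sub {n : ℕ} {t : ℕ → ℝ} (ht : ∀ i j, i < j → j < n → t i ≠ t j) {ι : Type*}
    (S : Finset ι) (a : ι → ℝ) {q i : ℕ} (hS : S.card ≤ q) (hi : i + q < n) :
    divDiff t (fun m => ∏ l ∈ S, (t m - a l)) q i = if S.card = q then 1 else 0 := by
  classical
  induction S using Finset.induction_on generalizing q i with
  | empty =>
    simp only [Finset.prod_empty]
    rcases q with _ | q
    · simp [divDiff]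
    · have hone : ∀ q i, divDiff t (fun _ => 1) (q + 1) i = 0 := by
        intro q
        induction q with
        | zero => simp [divDiff]
        | succ q ih =>
          intro i
          rw [divDiff, ih, ih, sub_zero, zero_div]
      rw [hone]
      simp
  | insert b S hb ih =>
    rw [Finset.card_insert_of_notMem hb] at hS ⊢
    obtain ⟨q, rfl⟩ : ∃ q', q = q' + 1 := ⟨q - 1, by omega⟩
    simp only [Finset.prod_insert hb]
    rw [divDiff_sub_mul ht _ _ hi, ih (by omega) hi, ih (by omega) (by omega),
      if_neg (by omega), mul_zero, zero_add]
    simp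

/-! ### The falling factorial basis -/

/-- Extension of a vector by zero to all natural numbers. -/
noncomputable def extend {n : ℕ} (v : Fin n → ℝ) (m : ℕ) : ℝ := if h : m < n then v ⟨m, h⟩ else 0

lemma extend_of_lt {n : ℕ} (v : Fin n → ℝ) {m : ℕ} (h : m < n) : extend v m = v ⟨m, h⟩ := dif_pos h

lemma diff1_mulVec {m : ℕ} (v : Fin m → ℝ) (i : Fin (m - 1)) :
    (diff1 m *ᵥ v) i = v ⟨i + 1, by have := i.isLt; omega⟩ - v ⟨i, by have := i.isLt; omega⟩ := by
  have hi := i.isLt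
  have : ∀ j : Fin m, diff1 m i j * v j =
      (if j = ⟨i + 1, by omega⟩ then v j else 0) - (if j = ⟨i, by omega⟩ then v j else 0) := by
    intro j
    simp only [diff1, Matrix.of_apply, Fin.ext_iff]
    split_ifs <;> first | omega | simp
  simp only [Matrix.mulVec, dotProduct, this, Finset.sum_sub_distrib, Finset.sum_ite_eq',
    Finset.mem_univ, if_true]

/-- The discrete derivative is a scaled increment of divided differences. -/
lemma diffOp_mulVec {n : ℕ} (t v : Fin n → ℝ) (k : ℕ) (i : Fin (n - (k + 1))) :
    (diffOp t k *ᵥ v) i =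
      k.factorial * (divDiff (extend t) (extend v) k (i + 1) -
        divDiff (extend t) (extend v) k i) := by
  induction k with
  | zero =>
    have hi := i.isLt
    have h := diff1_mulVec v i
    simp only [diffOp, divDiff, Nat.factorial_zero, Nat.cast_one, one_mul]
    rw [extend_of_lt v (by omega), extend_of_lt v (by omega)]
    exact h
  | succ k ih =>
    have hi := i.isLt
    simp only [diffOp]
    rw [← Matrix.mulVec_mulVec, ← Matrix.mulVec_mulVec]
    refine (diff1_mulVec _ i).trans ?_
    rw [Matrix.mulVec_diagonal, Matrix.mulVec_diagonal, ih, ih]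
    simp only [divDiff, Nat.factorial_succ]
    rw [extend_of_lt t (m := i + 1 + (k + 1)) (by omega), extend_of_lt t (m := i + 1) (by omega),
      extend_of_lt t (m := i + (k + 1)) (by omega), extend_of_lt t (m := i) (by omega)]
    push_cast
    ring

lemma extend_ne {n : ℕ} {t : Fin n → ℝ} (ht : StrictMono t) (i j : ℕ) (hij : i < j) (hj : j < n) :
    extend t i ≠ extend t j := by
  rw [extend_of_lt t hj, extend_of_lt t (hij.trans hj)]
  exact (ht (Fin.mk_lt_mk.2 hij)).ne

/-- The discrete derivatives of order `k + 1` annihilate the polynomial basis functions and send the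
knot-producing ones to multiples of the unit vectors. -/
lemma diffOp_ffBasis {n : ℕ} {t : Fin n → ℝ} (ht : StrictMono t) (k : ℕ) (c : Fin n)
    (i : Fin (n - (k + 1))) :
    (diffOp t k *ᵥ fun m => ffBasis t k c (t m)) i =
      if c.val = i.val + (k + 1) then (k.factorial : ℝ) else 0 := by
  have hi := i.isLt
  have hc := c.isLt
  rw [diffOp_mulVec]
  by_cases hck : c.val ≤ k
  · have hcard : (Finset.univ.filter fun l : Fin n => l.val < c.val).card = c.val := by
      rw [← Finset.card_map Fin.valEmbedding]
      conv_rhs => rw [← Finset.card_range c.val]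
      congr 1
      ext m
      simp only [Finset.mem_map, Finset.mem_filter, Finset.mem_univ, true_and,
        Fin.valEmbedding_apply, Finset.mem_range]
      exact ⟨by rintro ⟨l, h, rfl⟩; exact h, fun h => ⟨⟨m, by omega⟩, h, rfl⟩⟩
    have key : ∀ p, p + k < n →
        divDiff (extend t) (extend fun m => ffBasis t k c (t m)) k p =
          if c.val = k then 1 else 0 := by
      intro p hp
      rw [divDiff_congr (g := fun m => ∏ l : Fin n with l.val < c.val, (extend t m - t l)),
        divDiff_prod_sub (extend_ne ht) _ t (by omega) hp, hcard]
      intro m _ hm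
      rw [extend_of_lt _ (by omega), extend_of_lt t (m := m) (by omega), ffBasis, if_pos hck]
    rw [key _ (by omega), key _ (by omega), sub_self, mul_zero, if_neg (by omega)]
  · have hcard : (Finset.univ.filter fun l : Fin n =>
        l.val < c.val ∧ c.val ≤ l.val + k).card = k := by
      have h2 : (Finset.Ico (c.val - k) c.val).card = k := by
        rw [Nat.card_Ico]
        omega
      rw [← Finset.card_map Fin.valEmbedding]
      conv_rhs => rw [← h2]
      congr 1
      ext m
      simp only [Finset.mem_map, Finset.mem_filter, Finset.mem_univ, true_and,
        Fin.valEmbedding_apply, Finset.mem_Ico]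
      exact ⟨by rintro ⟨l, h, rfl⟩; omega, fun h => ⟨⟨m, by omega⟩, by dsimp only; omega, rfl⟩⟩
    have key : ∀ p, p + k < n →
        divDiff (extend t) (extend fun m => ffBasis t k c (t m)) k p =
          if c.val ≤ p + k then 1 else 0 := by
      intro p hp
      by_cases hpc : c.val ≤ p + k
      · rw [divDiff_congr (g := fun m =>
            ∏ l : Fin n with l.val < c.val ∧ c.val ≤ l.val + k, (extend t m - t l)),
          divDiff_prod_sub (extend_ne ht) _ t hcard.le hp, hcard, if_pos rfl, if_pos hpc]
        intro m h1 h2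
        rw [extend_of_lt _ (by omega), extend_of_lt t (m := m) (by omega), ffBasis, if_neg hck]
        by_cases hm : c.val ≤ m
        · rw [if_pos (ht (Fin.mk_lt_mk.2 (by omega))), mul_one]
        · rw [Finset.prod_eq_zero (i := ⟨m, by omega⟩)
            (by simp only [Finset.mem_filter, Finset.mem_univ, true_and]; omega) (sub_self _),
            zero_mul]
      · rw [divDiff_congr (g := fun _ => 0), divDiff_zero, if_neg hpc]
        intro m h1 h2
        rw [extend_of_lt _ (by omega), ffBasis, if_neg hck, if_neg, mul_zero]
        rw [not_lt, ht.le_iff_le, Fin.mk_le_mk]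
        omega
    rw [key _ (by omega), key _ (by omega)]
    by_cases h1 : c.val = i.val + (k + 1)
    · rw [if_pos (by omega), if_neg (by omega), if_pos h1]
      ring
    · by_cases h2 : c.val ≤ i.val + k
      · rw [if_pos (by omega), if_pos h2, if_neg h1]
        ring
      · rw [if_neg (by omega), if_neg h2, if_neg h1]
        ring

lemma strictMono_sorted {n : ℕ} {x : Fin n → ℝ} (hx : Function.Injective x) :
    StrictMono (sorted x) :=
  (Tuple.monotone_sort x).strictMono_of_injective (hx.comp (Tuple.sort x).injective)

lemma discreteDeriv_ffMatrix_mulVec {n : ℕ} {x : Fin n → ℝ} (hx : Function.Injective x) (k : ℕ)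
    (c : Fin n → ℝ) (l : Fin (n - (k + 1))) :
    discreteDeriv x k (ffMatrix x k *ᵥ c) l =
      k.factorial * c ⟨l + (k + 1), by have := l.isLt; omega⟩ := by
  have hl := l.isLt
  have h1 : sortBy x (ffMatrix x k *ᵥ c) =
      (Matrix.of fun m c' => ffBasis (sorted x) k c' (sorted x m)) *ᵥ c := rfl
  rw [discreteDeriv, h1, Matrix.mulVec_mulVec]
  have h2 : ∀ c', (diffOp (sorted x) k *
      Matrix.of fun m c' => ffBasis (sorted x) k c' (sorted x m)) l c' =
        if c' = ⟨l + (k + 1), by omega⟩ then (k.factorial : ℝ) else 0 := by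
    intro c'
    have := diffOp_ffBasis (strictMono_sorted hx) k c' l
    simp only [Fin.ext_iff]
    exact this
  simp only [Matrix.mulVec, dotProduct, h2, ite_mul, zero_mul, Finset.sum_ite_eq', Finset.mem_univ,
    if_true]

/-- After sorting the rows, the falling factorial basis matrix is lower triangular. -/
lemma det_ffMatrix_ne_zero {n : ℕ} {x : Fin n → ℝ} (hx : Function.Injective x) (k : ℕ) :
    (ffMatrix x k).det ≠ 0 := by
  have ht := strictMono_sorted hx
  set T : Matrix (Fin n) (Fin n) ℝ := (ffMatrix x k).submatrix (Tuple.sort x) id with hT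
  have hTapp : ∀ m c, T m c = ffBasis (sorted x) k c (sorted x m) := fun _ _ => rfl
  have hdet := Matrix.det_permute (Tuple.sort x) (ffMatrix x k)
  rw [← hT, Matrix.det_of_isLowerTriangular T] at hdet
  · intro h0
    rw [h0, mul_zero, Finset.prod_eq_zero_iff] at hdet
    obtain ⟨m, -, hm⟩ := hdet
    rw [hTapp, ffBasis] at hm
    split_ifs at hm with h1 h2
    · obtain ⟨l, hl, hl0⟩ := Finset.prod_eq_zero_iff.1 hm
      have := ht (Fin.lt_def.2 (Finset.mem_filter.1 hl).2)
      linarith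
    · rw [mul_one] at hm
      obtain ⟨l, hl, hl0⟩ := Finset.prod_eq_zero_iff.1 hm
      have := ht (Fin.lt_def.2 (Finset.mem_filter.1 hl).2.1)
      linarith
    · refine h2 (ht (Fin.lt_def.2 ?_))
      dsimp only
      omega
  · intro m c hmc
    have hmc : m.val < c.val := hmc
    rw [hTapp, ffBasis]
    split_ifs with h1 h2
    · exact Finset.prod_eq_zero (i := m) (by simpa using hmc) (sub_self _)
    · have := Fin.lt_def.1 (ht.lt_iff_lt.1 h2)
      dsimp only at this
      omega
    · rw [mul_zero]

/-- The columns of the falling factorial basis matrix split into the constant column, the other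
polynomial columns and the knot-producing columns. -/
noncomputable def ffIndex {n k : ℕ} (hk : k < n) :
    (Unit ⊕ Fin k) ⊕ Fin (n - (k + 1)) ≃ Fin n :=
  Equiv.ofBijective
    (Sum.elim (Sum.elim (fun _ => ⟨0, by omega⟩) fun m => ⟨m + 1, by have := m.isLt; omega⟩)
      fun l => ⟨l + (k + 1), by have := l.isLt; omega⟩)
    ⟨by
      rintro ((_ | m) | l) ((_ | m') | l') h <;>
        simp only [Sum.elim_inl, Sum.elim_inr, Sum.inl.injEq, Sum.inr.injEq,
          Fin.ext_iff, reduceCtorEq] at h ⊢ <;> omega, by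
      intro c
      have hc := c.isLt
      by_cases h0 : c.val = 0
      · exact ⟨Sum.inl (Sum.inl ()), Fin.ext h0.symm⟩
      by_cases h1 : c.val ≤ k
      · exact ⟨Sum.inl (Sum.inr ⟨c - 1, by omega⟩), Fin.ext (by simp; omega)⟩
      · exact ⟨Sum.inr ⟨c - (k + 1), by omega⟩, Fin.ext (by simp; omega)⟩⟩

lemma ffMatrix_mulVec {n k : ℕ} (hk : k < n) (x : Fin n → ℝ) (c : Fin n → ℝ) :
    ffMatrix x k *ᵥ c = (fun _ => c ⟨0, by omega⟩) +
      (polyMatrix x k hk *ᵥ (fun m => c (ffIndex hk (Sum.inl (Sum.inr m)))) +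
        knotMatrix x k *ᵥ fun l => c (ffIndex hk (Sum.inr l))) := by
  ext i
  have h0 : ffMatrix x k i ⟨0, by omega⟩ = 1 := by
    change ffBasis (sorted x) k ⟨0, _⟩ (x i) = 1
    rw [ffBasis, if_pos (Nat.zero_le k)]
    exact Finset.prod_eq_one fun l hl =>
      absurd (Finset.mem_filter.1 hl).2 (Nat.not_lt_zero l.val)
  change ∑ j, ffMatrix x k i j * c j = _
  rw [← (ffIndex hk).sum_comp, Fintype.sum_sum_type, Fintype.sum_sum_type, Fintype.sum_unique,
    add_assoc]
  change ffMatrix x k i ⟨0, by omega⟩ * c ⟨0, by omega⟩ + _ = _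
  rw [h0, one_mul]
  rfl

lemma centering_mulVec {n : ℕ} (v : Fin n → ℝ) (i : Fin n) :
    (centering n *ᵥ v) i = v i - mean v := by
  rw [centering, Matrix.sub_mulVec, Matrix.one_mulVec]
  simp [mean, Matrix.mulVec, dotProduct, Finset.mul_sum, div_eq_inv_mul]

lemma centering_transpose (n : ℕ) : (centering n)ᵀ = centering n := by
  simp only [centering, Matrix.transpose_sub, Matrix.transpose_one]
  rfl

lemma sum_centering_mulVec {n : ℕ} (v : Fin n → ℝ) : ∑ i, (centering n *ᵥ v) i = 0 := by
  rcases Nat.eq_zero_or_pos n with rfl | hn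
  · simp
  · have : (n : ℝ) ≠ 0 := by positivity
    simp only [centering_mulVec, Finset.sum_sub_distrib, Finset.sum_const, Finset.card_univ,
      Fintype.card_fin, nsmul_eq_mul, mean]
    field_simp
    ring

lemma centering_mulVec_of_sum_eq_zero {n : ℕ} {v : Fin n → ℝ} (hv : ∑ i, v i = 0) :
    centering n *ᵥ v = v := by
  ext i
  simp [centering_mulVec, mean, hv]

/-- The centered component with coefficients `a` on the nonconstant polynomial basis functions and
`α` on the knot-producing ones. -/
noncomputable def component {n k : ℕ} (hk : k < n) (x : Fin n → ℝ) (a : Fin k → ℝ)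
    (α : Fin (n - (k + 1)) → ℝ) : Fin n → ℝ :=
  centering n *ᵥ (polyMatrix x k hk *ᵥ a + knotMatrix x k *ᵥ α)

section component

variable {n k : ℕ} (hk : k < n) {x : Fin n → ℝ}

lemma exists_component_eq_ffMatrix_mulVec (a : Fin k → ℝ) (α : Fin (n - (k + 1)) → ℝ) :
    ∃ c, component hk x a α = ffMatrix x k *ᵥ c ∧
      (∀ m, c (ffIndex hk (Sum.inl (Sum.inr m))) = a m) ∧ ∀ l, c (ffIndex hk (Sum.inr l)) = α l := by
  set v := polyMatrix x k hk *ᵥ a + knotMatrix x k *ᵥ α with hv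
  refine ⟨Sum.elim (Sum.elim (fun _ => -mean v) a) α ∘ (ffIndex hk).symm, ?_, by simp, by simp⟩
  rw [ffMatrix_mulVec hk]
  have h0 : (⟨0, by omega⟩ : Fin n) = ffIndex hk (Sum.inl (Sum.inl ())) := rfl
  simp only [h0, Function.comp_apply, Equiv.symm_apply_apply, Sum.elim_inl, Sum.elim_inr]
  ext i
  change (centering n *ᵥ v) i = -mean v + v i
  rw [centering_mulVec]
  ring

lemma discreteDeriv_component (hx : Function.Injective x) (a : Fin k → ℝ)
    (α : Fin (n - (k + 1)) → ℝ) (l : Fin (n - (k + 1))) :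
    discreteDeriv x k (component hk x a α) l = k.factorial * α l := by
  obtain ⟨c, h, -, hα⟩ := exists_component_eq_ffMatrix_mulVec hk (x := x) a α
  rw [h, discreteDeriv_ffMatrix_mulVec hx, ← hα]
  rfl

lemma eq_zero_of_component_eq_zero (hx : Function.Injective x) {a : Fin k → ℝ}
    {α : Fin (n - (k + 1)) → ℝ} (h0 : component hk x a α = 0) : a = 0 ∧ α = 0 := by
  obtain ⟨c, h, ha, hα⟩ := exists_component_eq_ffMatrix_mulVec hk (x := x) a α
  have hc : c = 0 := Matrix.eq_zero_of_mulVec_eq_zero (det_ffMatrix_ne_zero hx k) (h.symm.trans h0)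
  subst hc
  exact ⟨funext fun m => (ha m).symm, funext fun l => (hα l).symm⟩

lemma exists_component_eq (hx : Function.Injective x) {θ : Fin n → ℝ} (hθ : ∑ i, θ i = 0) :
    ∃ a α, component hk x a α = θ := by
  have hu : IsUnit (ffMatrix x k).det := (det_ffMatrix_ne_zero hx k).isUnit
  set c := (ffMatrix x k)⁻¹ *ᵥ θ
  have hc : ffMatrix x k *ᵥ c = θ := by
    rw [Matrix.mulVec_mulVec, Matrix.mul_nonsing_inv _ hu, Matrix.one_mulVec]
  refine ⟨fun m => c (ffIndex hk (Sum.inl (Sum.inr m))), fun l => c (ffIndex hk (Sum.inr l)), ?_⟩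
  rw [ffMatrix_mulVec hk, ← eq_sub_iff_add_eq'] at hc
  rw [component, hc, Matrix.mulVec_sub, centering_mulVec_of_sum_eq_zero hθ, sub_eq_self]
  have hn : (n : ℝ) ≠ 0 := by
    have : n ≠ 0 := by omega
    exact_mod_cast this
  ext i
  simp [centering_mulVec, mean, hn]

end component

/-! ### Stein's identity for Gaussian vectors -/

section Stein

variable {ν : Type*} [Fintype ν] {η : ν → ℝ} {v : ℝ≥0}

/-- The density of the product of the normal distributions with means `η i` and variance `v`. -/
noncomputable def gaussDensity (η : ν → ℝ) (v : ℝ≥0) (y : ν → ℝ) : ℝ :=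
  ∏ i, gaussianPDFReal (η i) v (y i)

lemma measurable_gaussDensity : Measurable (gaussDensity η v) :=
  Finset.measurable_prod _ fun i _ => (measurable_gaussianPDFReal _ _).comp (measurable_pi_apply i)

lemma gaussDensity_nonneg (y : ν → ℝ) : 0 ≤ gaussDensity η v y :=
  Finset.prod_nonneg fun _ _ => gaussianPDFReal_nonneg _ _ _

lemma pi_gaussianReal_eq_withDensity (hv : v ≠ 0) :
    Measure.pi (fun i => gaussianReal (η i) v) =
      (volume : Measure (ν → ℝ)).withDensity fun y => ENNReal.ofReal (gaussDensity η v y) := by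
  refine Measure.pi_eq fun s hs => ?_
  unfold gaussDensity
  rw [withDensity_apply _ (MeasurableSet.univ_pi hs), volume_pi, Measure.restrict_pi_pi,
    ← ofReal_integral_eq_lintegral_ofReal
      (Integrable.fintype_prod fun i => (integrable_gaussianPDFReal (η i) v).restrict)
      (Eventually.of_forall gaussDensity_nonneg)]
  rw [integral_fintype_prod_eq_prod (fun i => gaussianPDFReal (η i) v), ENNReal.ofReal_prod_of_nonneg
    fun i _ => integral_nonneg fun _ => gaussianPDFReal_nonneg _ _ _]
  exact Finset.prod_congr rfl fun i _ => (gaussianReal_apply_eq_integral (η i) hv (s i)).symm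

lemma pi_gaussianReal_absolutelyContinuous (hv : v ≠ 0) :
    Measure.pi (fun i => gaussianReal (η i) v) ≪ (volume : Measure (ν → ℝ)) := by
  rw [pi_gaussianReal_eq_withDensity hv]
  exact withDensity_absolutelyContinuous _ _

lemma integral_pi_gaussianReal (hv : v ≠ 0) (F : (ν → ℝ) → ℝ) :
    ∫ y, F y ∂Measure.pi (fun i => gaussianReal (η i) v) = ∫ y, gaussDensity η v y * F y := by
  rw [pi_gaussianReal_eq_withDensity hv, integral_withDensity_eq_integral_toReal_smul
    measurable_gaussDensity.ennreal_ofReal (Eventually.of_forall fun _ => ENNReal.ofReal_lt_top)]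
  simp only [ENNReal.toReal_ofReal (gaussDensity_nonneg _), smul_eq_mul]

lemma memLp_eval_pi_gaussianReal (i : ν) :
    MemLp (fun y : ν → ℝ => y i) 2 (Measure.pi fun i => gaussianReal (η i) v) :=
  (memLp_id_gaussianReal (μ := η i) (v := v) 2).comp_measurePreserving
    (measurePreserving_eval (fun i => gaussianReal (η i) v) i)

lemma memLp_exp_mul_eval_pi_gaussianReal (i : ν) (c : ℝ) :
    MemLp (fun y : ν → ℝ => Real.exp (c * (y i - η i))) 2
      (Measure.pi fun i => gaussianReal (η i) v) := by
  rw [memLp_two_iff_integrable_sq (Continuous.aestronglyMeasurable (by fun_prop))]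
  have h := (measurePreserving_eval (fun i => gaussianReal (η i) v) i).integrable_comp_of_integrable
    (integrable_exp_mul_gaussianReal (μ := η i) (v := v) (2 * c))
  refine (h.const_mul (Real.exp (-(2 * c * η i)))).congr (Eventually.of_forall fun y => ?_)
  simp only [Function.comp_apply, Function.eval]
  rw [← Real.exp_add, ← Real.exp_nat_mul]
  congr 1
  push_cast
  ring

variable [DecidableEq ν]

lemma gaussDensity_sub_single (hv : v ≠ 0) (y : ν → ℝ) (i : ν) (t : ℝ) :
    gaussDensity η v (y - Pi.single i t) =
      gaussDensity η v y * Real.exp (((y i - η i) * t - t ^ 2 / 2) / v) := by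
  have hv' : (v : ℝ) ≠ 0 := by exact_mod_cast hv
  have h : Real.exp (((y i - η i) * t - t ^ 2 / 2) / v) =
      ∏ j, if j = i then Real.exp (((y j - η j) * t - t ^ 2 / 2) / v) else 1 := by
    simp
  rw [h, gaussDensity, gaussDensity, ← Finset.prod_mul_distrib]
  refine Finset.prod_congr rfl fun j _ => ?_
  by_cases hj : j = i
  · subst hj
    rw [if_pos rfl, Pi.sub_apply, Pi.single_eq_same, gaussianPDFReal, gaussianPDFReal,
      mul_assoc _ (Real.exp _) (Real.exp _), ← Real.exp_add]
    congr 2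
    field_simp
    ring
  · rw [if_neg hj, Pi.sub_apply, Pi.single_eq_of_ne hj, sub_zero, mul_one]

/-- Shifting one coordinate of a Gaussian vector amounts to an exponential change of density. -/
lemma integral_add_single_pi_gaussianReal (hv : v ≠ 0) (f : (ν → ℝ) → ℝ) (i : ν) (t : ℝ) :
    ∫ y, f (y + Pi.single i t) ∂Measure.pi (fun i => gaussianReal (η i) v) =
      ∫ y, f y * Real.exp (((y i - η i) * t - t ^ 2 / 2) / v)
        ∂Measure.pi (fun i => gaussianReal (η i) v) := by
  rw [integral_pi_gaussianReal hv, integral_pi_gaussianReal hv]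
  have h := integral_add_right_eq_self (μ := (volume : Measure (ν → ℝ)))
    (fun y => gaussDensity η v (y - Pi.single i t) * f y) (Pi.single i t)
  simp only [add_sub_cancel_right] at h
  rw [h]
  refine integral_congr_ae (Eventually.of_forall fun y => ?_)
  dsimp only
  rw [gaussDensity_sub_single hv]
  ring

/-- Stein's identity: both sides are the derivative at zero of the mean of `f` at the vector whose
`i`th coordinate is shifted by `t`. -/
theorem integral_deriv_pi_gaussianReal (hv : v ≠ 0) {f D : (ν → ℝ) → ℝ} (i : ν) (hf : Continuous f)
    (hlip : ∀ y t, |f (y + Pi.single i t) - f y| ≤ |t|)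
    (hf2 : MemLp f 2 (Measure.pi fun i => gaussianReal (η i) v))
    (hD : ∀ᵐ y ∂Measure.pi (fun i => gaussianReal (η i) v),
      HasDerivAt (fun t => f (y + Pi.single i t)) (D y) 0) :
    Integrable D (Measure.pi fun i => gaussianReal (η i) v) ∧
      ∫ y, D y ∂Measure.pi (fun i => gaussianReal (η i) v) =
        ∫ y, f y * ((y i - η i) / v) ∂Measure.pi (fun i => gaussianReal (η i) v) := by
  set π := Measure.pi fun i => gaussianReal (η i) v with hπ
  have hv' : (0 : ℝ) < v := by exact_mod_cast pos_iff_ne_zero.2 hv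
  have hcont : ∀ t : ℝ, Continuous fun y : ν → ℝ => f (y + Pi.single i t) := fun t => by fun_prop
  have hint : Integrable f π := hf2.integrable (by norm_num)
  -- `D` is almost everywhere a limit of difference quotients.
  have hDmeas : AEStronglyMeasurable D π := by
    refine aestronglyMeasurable_of_tendsto_ae atTop
      (f := fun (m : ℕ) y => (1 / ((m : ℝ) + 1))⁻¹ •
        (f (y + Pi.single i (0 + 1 / ((m : ℝ) + 1))) - f (y + Pi.single i 0)))
      (fun m => Continuous.aestronglyMeasurable (by fun_prop)) ?_
    filter_upwards [hD] with y hy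
    refine hy.tendsto_slope_zero.comp (tendsto_nhdsWithin_iff.2
      ⟨tendsto_one_div_add_atTop_nhds_zero_nat, Eventually.of_forall fun m => ?_⟩)
    have : (0 : ℝ) < 1 / ((m : ℝ) + 1) := by positivity
    exact this.ne'
  have hleft := hasDerivAt_integral_of_dominated_loc_of_lip (μ := π)
    (F := fun t y => f (y + Pi.single i t)) (x₀ := (0 : ℝ)) (bound := fun _ => (1 : ℝ)) univ_mem
    (Eventually.of_forall fun t => (hcont t).aestronglyMeasurable) (by simpa using hint)
    hDmeas (Eventually.of_forall fun y => by
      refine LipschitzOnWith.of_dist_le_mul fun s _ t _ => ?_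
      have h := hlip (y + Pi.single i t) (s - t)
      rw [add_assoc, ← Pi.single_add, add_sub_cancel] at h
      simpa [Real.dist_eq] using h)
    (integrable_const _) hD
  refine ⟨hleft.1, ?_⟩
  -- The constant `c` is such that `exp (c * |z|)` absorbs both `exp (|z| / v)`, which bounds the
  -- density ratio for shifts of size at most one, and the linear factor from its derivative.
  set c : ℝ := 1 + 1 / v with hc
  have hright := hasDerivAt_integral_of_dominated_loc_of_deriv_le (μ := π)
    (F := fun t y => f y * Real.exp (((y i - η i) * t - t ^ 2 / 2) / v)) (x₀ := (0 : ℝ))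
    (F' := fun t y => f y * (Real.exp (((y i - η i) * t - t ^ 2 / 2) / v) *
      ((y i - η i - t) / v)))
    (bound := fun y => |f y| * ((1 / v) * (Real.exp (c * (y i - η i)) +
      Real.exp ((-c) * (y i - η i))))) (Metric.ball_mem_nhds (0 : ℝ) one_pos)
    (Eventually.of_forall fun t => Continuous.aestronglyMeasurable (by fun_prop))
    (by simpa using hint) (Continuous.aestronglyMeasurable (by fun_prop))
    (Eventually.of_forall fun y t ht => by
      rw [norm_mul, Real.norm_eq_abs]
      refine mul_le_mul_of_nonneg_left ?_ (abs_nonneg _)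
      set z := y i - η i
      have ht1 : |t| < 1 := by simpa using ht
      have h1 : |z - t| ≤ Real.exp |z| := by
        have := abs_sub z t
        have h2 := Real.add_one_le_exp |z|
        linarith
      have h2 : (z * t - t ^ 2 / 2) / v ≤ |z| / v := by
        refine div_le_div_of_nonneg_right ?_ hv'.le
        have h3 : z * t ≤ |z| * |t| := by
          rw [← abs_mul]
          exact le_abs_self _
        nlinarith [abs_nonneg z, sq_nonneg t]
      have h3 : Real.exp (c * |z|) ≤ Real.exp (c * z) + Real.exp (-c * z) := by
        rcases abs_cases z with ⟨h, -⟩ | ⟨h, -⟩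
        · rw [h]
          have := Real.exp_pos (-c * z)
          linarith
        · rw [h, mul_neg, ← neg_mul]
          have := Real.exp_pos (c * z)
          linarith
      rw [norm_mul, Real.norm_eq_abs, Real.norm_eq_abs, abs_div, abs_of_pos hv',
        abs_of_pos (Real.exp_pos _)]
      calc Real.exp ((z * t - t ^ 2 / 2) / v) * (|z - t| / v)
          ≤ Real.exp (|z| / v) * (Real.exp |z| / v) := by gcongr
        _ = (1 / v) * Real.exp (c * |z|) := by
          rw [hc, show (1 + 1 / (v : ℝ)) * |z| = |z| / v + |z| by ring, Real.exp_add]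
          ring
        _ ≤ _ := by gcongr)
    (by
      have h := (memLp_exp_mul_eval_pi_gaussianReal (η := η) (v := v) i c).add
        (memLp_exp_mul_eval_pi_gaussianReal (η := η) (v := v) i (-c))
      exact hf2.abs.integrable_mul (h.const_mul _))
    (Eventually.of_forall fun y t _ => by
      have h1 : HasDerivAt (fun t : ℝ => ((y i - η i) * t - t ^ 2 / 2) / v)
          ((y i - η i - t) / v) t := by
        have h2 := ((hasDerivAt_id t).const_mul (y i - η i)).sub
          ((hasDerivAt_pow 2 t).div_const 2)
        refine (h2.div_const (v : ℝ)).congr_deriv ?_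
        push_cast
        ring
      exact h1.exp.const_mul (f y))
  have heq := hleft.2.unique (hright.2.congr_of_eventuallyEq
    (Eventually.of_forall fun t => integral_add_single_pi_gaussianReal hv f i t))
  rw [heq]
  simp

/-- The covariance form of Stein's identity. -/
theorem covariance_eval_pi_gaussianReal (hv : v ≠ 0) {f D : (ν → ℝ) → ℝ} (i : ν)
    (hf : Continuous f) (hlip : ∀ y t, |f (y + Pi.single i t) - f y| ≤ |t|)
    (hf2 : MemLp f 2 (Measure.pi fun i => gaussianReal (η i) v))
    (hD : ∀ᵐ y ∂Measure.pi (fun i => gaussianReal (η i) v),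
      HasDerivAt (fun t => f (y + Pi.single i t)) (D y) 0) :
    Integrable D (Measure.pi fun i => gaussianReal (η i) v) ∧
      covariance f (fun y => y i) (Measure.pi fun i => gaussianReal (η i) v) =
        v * ∫ y, D y ∂Measure.pi (fun i => gaussianReal (η i) v) := by
  obtain ⟨h1, h2⟩ := integral_deriv_pi_gaussianReal hv i hf hlip hf2 hD
  refine ⟨h1, ?_⟩
  have hv' : (v : ℝ) ≠ 0 := by exact_mod_cast hv
  set π := Measure.pi fun i => gaussianReal (η i) v with hπ
  have hi : MemLp (fun y : ν → ℝ => y i) 2 π := memLp_eval_pi_gaussianReal i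
  have hmean : ∫ y, y i ∂π = η i := by
    have h := integral_map (μ := π) (φ := Function.eval i) (f := fun x : ℝ => x)
      (measurable_pi_apply i).aemeasurable (by fun_prop)
    rw [(measurePreserving_eval (fun i => gaussianReal (η i) v) i).map_eq,
      integral_id_gaussianReal] at h
    exact h.symm
  rw [covariance_eq_sub hf2 hi, h2, hmean, ← integral_const_mul]
  have : ∀ y : ν → ℝ, v * (f y * ((y i - η i) / v)) = (f * fun y : ν → ℝ => y i) y - f y * η i := by
    intro y
    simp only [Pi.mul_apply]
    field_simp
  simp only [this]
  rw [integral_sub (hf2.integrable_mul hi) ((hf2.integrable (by norm_num)).mul_const _),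
    integral_mul_const]

/-- For a nonexpansive map `g` that is almost everywhere locally affine, the sum of the covariances
of its coordinates with those of a Gaussian vector is the variance times the mean of the trace of
its linear part. -/
theorem sum_covariance_pi_gaussianReal (hv : v ≠ 0) {g : (ν → ℝ) → ν → ℝ} {N : (ν → ℝ) → ℝ}
    (hg : ∀ y y', ∑ i, (g y i - g y' i) ^ 2 ≤ ∑ i, (y i - y' i) ^ 2)
    (hN : ∀ᵐ y ∂(volume : Measure (ν → ℝ)), ∃ Q : Matrix ν ν ℝ,
      (∀ᶠ y' in 𝓝 y, g y' - g y = Q *ᵥ (y' - y)) ∧ Q.trace = N y) :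
    (∀ i, Continuous fun y => g y i) ∧
    (∀ i, MemLp (fun y => g y i) 2 (Measure.pi fun i => gaussianReal (η i) v)) ∧
      Integrable N (Measure.pi fun i => gaussianReal (η i) v) ∧
      ∑ i, covariance (fun y => g y i) (fun y => y i) (Measure.pi fun i => gaussianReal (η i) v) =
        v * ∫ y, N y ∂Measure.pi (fun i => gaussianReal (η i) v) := by
  set π := Measure.pi fun i => gaussianReal (η i) v with hπ
  have hcoord : ∀ i y y', |g y i - g y' i| ≤ √(∑ i, (y i - y' i) ^ 2) := by
    intro i y y'
    refine Real.abs_le_sqrt (le_trans ?_ (hg y y'))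
    exact Finset.single_le_sum (f := fun i => (g y i - g y' i) ^ 2) (fun i _ => sq_nonneg _)
      (Finset.mem_univ i)
  have hcont : ∀ i, Continuous fun y => g y i := by
    intro i
    rw [continuous_iff_continuousAt]
    intro y
    rw [ContinuousAt, tendsto_iff_norm_sub_tendsto_zero]
    refine squeeze_zero (fun _ => norm_nonneg _) (fun y' => hcoord i y' y) ?_
    have : Continuous fun y' : ν → ℝ => √(∑ i, (y' i - y i) ^ 2) := by fun_prop
    simpa using this.tendsto y
  have hmem : ∀ i, MemLp (fun y => g y i) 2 π := by
    intro i
    have h1 : MemLp (fun y : ν → ℝ => √(∑ i, (y i - (0 : ν → ℝ) i) ^ 2)) 2 π := by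
      rw [memLp_two_iff_integrable_sq (Continuous.aestronglyMeasurable (by fun_prop))]
      have : ∀ y : ν → ℝ, √(∑ i, (y i - (0 : ν → ℝ) i) ^ 2) ^ 2 = ∑ i, y i ^ 2 := by
        intro y
        rw [Real.sq_sqrt (Finset.sum_nonneg fun i _ => sq_nonneg _)]
        simp
      simp only [this]
      exact integrable_finsetSum _ fun j _ => (memLp_eval_pi_gaussianReal j).integrable_sq
    refine ((memLp_const |g 0 i|).add h1).mono' (hcont i).aestronglyMeasurable
      (Eventually.of_forall fun y => ?_)
    have h2 := hcoord i y 0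
    have h3 := abs_sub_abs_le_abs_sub (g y i) (g 0 i)
    rw [Real.norm_eq_abs]
    simp only [Pi.add_apply]
    linarith
  have hlip : ∀ i y t, |g (y + Pi.single i t) i - g y i| ≤ |t| := by
    intro i y t
    refine (hcoord i _ _).trans_eq ?_
    rw [Finset.sum_eq_single i]
    · simp [Real.sqrt_sq_eq_abs]
    · intro j _ hj
      simp [hj]
    · simp
  have hac : ∀ᵐ y ∂π, ∃ Q : Matrix ν ν ℝ,
      (∀ᶠ y' in 𝓝 y, g y' - g y = Q *ᵥ (y' - y)) ∧ Q.trace = N y :=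
    (pi_gaussianReal_absolutelyContinuous hv).ae_le hN
  have hderiv : ∀ i y, ∀ Q : Matrix ν ν ℝ, (∀ᶠ y' in 𝓝 y, g y' - g y = Q *ᵥ (y' - y)) →
      HasDerivAt (fun t => g (y + Pi.single i t) i) (Q i i) 0 := by
    intro i y Q hQ
    have htend : Tendsto (fun t : ℝ => y + Pi.single i t) (𝓝 0) (𝓝 y) := by
      have : Continuous fun t : ℝ => y + Pi.single i t :=
        continuous_const.add (continuous_const.update i continuous_id)
      simpa using this.tendsto 0
    have h1 : HasDerivAt (fun t : ℝ => g y i + t * Q i i) (Q i i) 0 := by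
      simpa using ((hasDerivAt_id (0 : ℝ)).mul_const (Q i i)).const_add (g y i)
    refine h1.congr_of_eventuallyEq ?_
    filter_upwards [htend.eventually hQ] with t ht
    have h2 := congrFun ht i
    rw [add_sub_cancel_left, Pi.sub_apply, sub_eq_iff_eq_add'] at h2
    rw [h2]
    simp [Matrix.mulVec_single, mul_comm]
  set D : ν → (ν → ℝ) → ℝ := fun i y => deriv (fun t => g (y + Pi.single i t) i) 0 with hDdef
  have hD : ∀ i, ∀ᵐ y ∂π, HasDerivAt (fun t => g (y + Pi.single i t) i) (D i y) 0 := by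
    intro i
    filter_upwards [hac] with y ⟨Q, hQ, _⟩
    exact (hderiv i y Q hQ).differentiableAt.hasDerivAt
  have hND : (fun y => ∑ i, D i y) =ᵐ[π] N := by
    filter_upwards [hac] with y ⟨Q, hQ, hQN⟩
    rw [← hQN, Matrix.trace]
    exact Finset.sum_congr rfl fun i _ => (hderiv i y Q hQ).deriv
  have hst := fun i => covariance_eval_pi_gaussianReal hv i (hcont i) (hlip i) (hmem i) (hD i)
  refine ⟨hcont, hmem, (integrable_finsetSum _ fun i _ => (hst i).1).congr hND, ?_⟩
  rw [← integral_congr_ae hND, integral_finsetSum _ fun i _ => (hst i).1, Finset.mul_sum]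
  exact Finset.sum_congr rfl fun i _ => (hst i).2

end Stein

/-! ### General position -/

lemma linearIndepOn_of_forall {ν κ : Type*} [Fintype κ] {W : Matrix ν κ ℝ} {S : Set κ}
    (h : ∀ b : κ → ℝ, (∀ c, c ∉ S → b c = 0) → W *ᵥ b = 0 → b = 0) :
    LinearIndepOn ℝ W.col S := by
  classical
  rw [linearIndepOn_iff']
  intro t g hts hsum c hc
  have hb := h (fun c => if c ∈ t then g c else 0) (fun c hcS => if_neg fun hct => hcS (hts hct)) (by
    rw [← hsum]
    ext i
    simp [Matrix.mulVec, dotProduct, Finset.sum_apply, mul_comm])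
  simpa [hc] using congrFun hb c

/-- For columns in general position, those which attain one common positive absolute correlation
with a given vector are linearly independent: otherwise a signed column would be a linear
combination of others, and pairing with the vector shows that the coefficients, after adjusting
signs, add up to one. -/
lemma GeneralPosition.linearIndepOn {ν κ : Type*} [Fintype ν] [Fintype κ] {A : Matrix ν κ ℝ}
    (hA : GeneralPosition A) (u : ν → ℝ) {Λ : ℝ} (hΛ : 0 < Λ) :
    LinearIndepOn ℝ A.col {c | |(u ᵥ* A) c| = Λ} := by
  classical
  set E : Set κ := {c | |(u ᵥ* A) c| = Λ} with hE
  obtain ⟨T, hTE, -, hspan, hT⟩ :=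
    exists_linearIndepOn_extension (linearIndepOn_empty ℝ A.col) (Set.empty_subset E)
  obtain ⟨T, rfl⟩ : ∃ T' : Finset κ, (T' : Set κ) = T := ⟨T.toFinset, by simp⟩
  -- `T` is a maximal independent subset of `E`, so a column of `E` outside `T` lies in its span.
  suffices hsub : E ⊆ T from hT.mono hsub
  intro c hcE
  by_contra hcT
  obtain ⟨g, hg⟩ := (Submodule.mem_span_image_finset_iff_exists_fun' ℝ).1
    (hspan (Set.mem_image_of_mem _ hcE))
  set s : κ → ℝ := fun c => if 0 ≤ (u ᵥ* A) c then 1 else -1 with hs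
  have hs1 : ∀ c, s c = 1 ∨ s c = -1 := fun c => by
    simp only [hs]
    split_ifs <;> simp
  have hss : ∀ c, s c * s c = 1 := fun c => by
    rcases hs1 c with h | h <;> rw [h] <;> norm_num
  have hsE : ∀ c ∈ E, (u ᵥ* A) c = s c * Λ := by
    intro c hc
    have hc : |(u ᵥ* A) c| = Λ := hc
    simp only [hs]
    split_ifs with h
    · rw [← hc, abs_of_nonneg h, one_mul]
    · rw [← hc, abs_of_neg (not_le.1 h)]
      ring
  have hpair : s c = ∑ j ∈ T, g j * s j := by
    have h1 : (u ᵥ* A) c = ∑ j ∈ T, g j * (u ᵥ* A) j := by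
      change u ⬝ᵥ A.col c = _
      rw [← hg, dotProduct_sum]
      refine Finset.sum_congr rfl fun j _ => ?_
      rw [dotProduct_smul]
      rfl
    rw [hsE c hcE, Finset.sum_congr rfl fun j hj => by rw [hsE j (hTE hj), ← mul_assoc],
      ← Finset.sum_mul] at h1
    exact mul_right_cancel₀ hΛ.ne' h1
  -- A zero column has zero correlation, so it does not belong to `E`.
  have hTne : T.Nonempty := by
    rw [Finset.nonempty_iff_ne_empty]
    rintro rfl
    have := hss c
    rw [hpair] at this
    simp at this
  have hmem : s c • A.col c ∈ affineSpan ℝ ((fun c' => s c' • A.col c') '' (T : Set κ)) := by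
    have hw : ∑ j ∈ T, s c * g j * s j = 1 := by
      rw [← hss c]
      nth_rewrite 3 [hpair]
      rw [Finset.mul_sum]
      exact Finset.sum_congr rfl fun j _ => mul_assoc _ _ _
    have h := affineCombination_mem_affineSpan_image (s' := (T : Set κ)) hw
      (fun j hj hj' => absurd hj hj') (fun c' => s c' • A.col c')
    rw [Finset.affineCombination_eq_linear_combination _ _ _ hw] at h
    convert h using 1
    rw [← hg, Finset.smul_sum]
    refine Finset.sum_congr rfl fun j _ => ?_
    rw [smul_smul, smul_smul, mul_assoc (s c * g j), hss, mul_one]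
  -- Independence bounds `T.card = ℓ + 1` by the number of rows, as general position requires.
  have hcard : T.card ≤ Fintype.card ν := by
    have := LinearIndependent.fintype_card_le_finrank hT
    simpa using this
  have hcard' : T.card ≤ Fintype.card κ := T.card_le_univ
  have hpos := hTne.card_pos
  obtain ⟨h1, h2⟩ := hA (T.card - 1) (by rw [lt_min_iff]; omega) T (by omega) s hs1 c hcT
  rcases hs1 c with h | h
  · rw [h, one_smul] at hmem
    exact h1 hmem
  · rw [h, neg_smul, one_smul] at hmem
    exact h2 hmem

/-! ### Additive trend filtering as a weighted lasso -/

section Additive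

variable {n d k : ℕ} (X : Matrix (Fin n) (Fin d) ℝ) (hk : k < n)

/-- The centered nonconstant basis functions of all input dimensions: the polynomial ones first,
then the knot-producing ones. -/
noncomputable def design : Matrix (Fin n) ((Fin d × Fin k) ⊕ (Fin d × Fin (n - (k + 1)))) ℝ :=
  centering n * Matrix.fromCols
    (Matrix.of fun i c => polyMatrix (fun i' => X i' c.1) k hk i c.2)
    (Matrix.of fun i c => knotMatrix (fun i' => X i' c.1) k i c.2)

/-- The penalty weights: polynomial coefficients are free, and a knot coefficient is a discrete
derivative divided by `k !`. -/
noncomputable def weight (n d k : ℕ) (lam : ℝ) :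
    (Fin d × Fin k) ⊕ (Fin d × Fin (n - (k + 1))) → ℝ :=
  Sum.elim (fun _ => 0) fun _ => lam * k.factorial

/-- The components of the additive model with coefficients `b`. -/
noncomputable def components (b : (Fin d × Fin k) ⊕ (Fin d × Fin (n - (k + 1))) → ℝ) (j : Fin d) :
    Fin n → ℝ :=
  component hk (fun i => X i j) (fun m => b (Sum.inl (j, m))) fun l => b (Sum.inr (j, l))

lemma design_mulVec (b : (Fin d × Fin k) ⊕ (Fin d × Fin (n - (k + 1))) → ℝ) (i : Fin n) :
    (design X hk *ᵥ b) i = ∑ j, components X hk b j i := by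
  have h : (Matrix.fromCols
      (Matrix.of fun i (c : Fin d × Fin k) => polyMatrix (fun i' => X i' c.1) k hk i c.2)
      (Matrix.of fun i (c : Fin d × Fin (n - (k + 1))) => knotMatrix (fun i' => X i' c.1) k i c.2))
        *ᵥ b = ∑ j, (polyMatrix (fun i => X i j) k hk *ᵥ (fun m => b (Sum.inl (j, m))) +
          knotMatrix (fun i => X i j) k *ᵥ fun l => b (Sum.inr (j, l))) := by
    ext i
    simp [Matrix.mulVec, dotProduct, Fintype.sum_sum_type, Fintype.sum_prod_type,
      Finset.sum_add_distrib, Finset.sum_apply]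
  rw [design, ← Matrix.mulVec_mulVec, h, Matrix.mulVec_sum, Finset.sum_apply]
  rfl

lemma centering_mul_centering (n : ℕ) : centering n * centering n = centering n := by
  refine Matrix.ext_of_mulVec_single fun i => ?_
  rw [← Matrix.mulVec_mulVec, centering_mulVec_of_sum_eq_zero (sum_centering_mulVec _)]

lemma vecMul_centering (y : Fin n → ℝ) : y ᵥ* centering n = centering n *ᵥ y := by
  rw [← Matrix.mulVec_transpose, centering_transpose]

lemma centering_mul_design : centering n * design X hk = design X hk := by
  rw [design, ← Matrix.mul_assoc, centering_mul_centering]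

lemma centering_mulVec_vecMul_design (y : Fin n → ℝ) :
    (centering n *ᵥ y) ᵥ* design X hk = y ᵥ* design X hk := by
  conv_rhs => rw [← centering_mul_design, ← Matrix.vecMul_vecMul, vecMul_centering]

lemma criterion_components (hX : ∀ j, Function.Injective fun i => X i j) (lam : ℝ) (y : Fin n → ℝ)
    (b : (Fin d × Fin k) ⊕ (Fin d × Fin (n - (k + 1))) → ℝ) :
    criterion X k lam y (components X hk b) =
      lassoObj (design X hk) (weight n d k lam) (centering n *ᵥ y) b := by
  unfold criterion lassoObj
  congr 1
  · simp only [centering_mulVec, design_mulVec]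
  · have h : ∀ j l, discreteDeriv (fun i => X i j) k (components X hk b j) l =
        k.factorial * b (Sum.inr (j, l)) := fun j l => discreteDeriv_component hk (hX j) _ _ l
    simp only [h, abs_mul, Nat.abs_cast, weight, Fintype.sum_sum_type, Sum.elim_inl, Sum.elim_inr,
      zero_mul, Finset.sum_const_zero, zero_add, Fintype.sum_prod_type, Finset.mul_sum, mul_assoc]

lemma exists_components_eq (hX : ∀ j, Function.Injective fun i => X i j) {θ : Fin d → Fin n → ℝ}
    (hθ : ∀ j, ∑ i, θ j i = 0) : ∃ b, components X hk b = θ := by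
  choose a α h using fun j => exists_component_eq hk (hX j) (hθ j)
  exact ⟨Sum.elim (fun c => a c.1 c.2) fun c => α c.1 c.2, funext h⟩

lemma weight_nonneg {lam : ℝ} (hlam : 0 ≤ lam) (c : (Fin d × Fin k) ⊕ (Fin d × Fin (n - (k + 1)))) :
    0 ≤ weight n d k lam c := by
  rcases c with c | c
  · exact le_rfl
  · exact mul_nonneg hlam (Nat.cast_nonneg _)

lemma isSolution_iff (hX : ∀ j, Function.Injective fun i => X i j) {lam : ℝ} (hlam : 0 ≤ lam)
    (y : Fin n → ℝ) (θ : Fin d → Fin n → ℝ) :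
    IsSolution X k lam y θ ↔ ∃ b, components X hk b = θ ∧
      Stationary (design X hk) (weight n d k lam) b (y - design X hk *ᵥ b) := by
  have hst : ∀ b, Stationary (design X hk) (weight n d k lam) b (y - design X hk *ᵥ b) ↔
      Stationary (design X hk) (weight n d k lam) b (centering n *ᵥ y - design X hk *ᵥ b) := by
    intro b
    unfold Stationary
    rw [Matrix.sub_vecMul, Matrix.sub_vecMul, centering_mulVec_vecMul_design]
  have hfeas : ∀ b j, ∑ i, components X hk b j i = 0 := fun b j => sum_centering_mulVec _
  constructor
  · rintro ⟨h0, hmin⟩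
    obtain ⟨b, rfl⟩ := exists_components_eq X hk hX h0
    refine ⟨b, rfl, (hst b).2 (stationary_of_forall_lassoObj_le (weight_nonneg hlam) fun b' => ?_)⟩
    rw [← criterion_components X hk hX, ← criterion_components X hk hX]
    exact hmin _ (hfeas b')
  · rintro ⟨b, rfl, hb⟩
    refine ⟨hfeas b, fun θ' hθ' => ?_⟩
    obtain ⟨b', rfl⟩ := exists_components_eq X hk hX hθ'
    rw [criterion_components X hk hX, criterion_components X hk hX]
    exact ((hst b).1 hb).lassoObj_le b'

/-- With a positive penalty, a residual orthogonal to the polynomial columns has the coordinates of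
its centered version in the frame `U`, and general position of the projected knot columns applies.
Without penalty there is at most one input dimension, and its basis functions are linearly
independent. -/
lemma nondegenerate_design (hX : ∀ j, Function.Injective fun i => X i j)
    (hP : LinearIndependent ℝ (Ptilde X k hk).col) {m : ℕ} {U : Matrix (Fin n) (Fin m) ℝ}
    (hU : IsOrthonormalComplement (Ptilde X k hk) U) (hK : GeneralPosition (Ktilde X k U))
    {lam : ℝ} (hlam : 0 ≤ lam) (hlam' : 2 ≤ d → 0 < lam) :
    Nondegenerate (design X hk) (weight n d k lam) := by
  intro r hr
  refine linearIndepOn_of_forall fun b hb h0 => ?_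
  rcases hlam.eq_or_lt with rfl | hpos
  · have hd : d ≤ 1 := by
      by_contra h
      exact lt_irrefl _ (hlam' (by omega))
    have : Subsingleton (Fin d) := Fin.subsingleton_iff_le_one.2 hd
    have hz : ∀ j, (fun m => b (Sum.inl (j, m))) = 0 ∧ (fun l => b (Sum.inr (j, l))) = 0 := by
      intro j
      refine eq_zero_of_component_eq_zero hk (hX j) ?_
      ext i
      have := congrFun h0 i
      rwa [design_mulVec, Fintype.sum_subsingleton _ j] at this
    ext (⟨j, m⟩ | ⟨j, l⟩)
    · exact congrFun (hz j).1 m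
    · exact congrFun (hz j).2 l
  · set K : Matrix (Fin n) (Fin d × Fin (n - (k + 1))) ℝ :=
      Matrix.of fun i c => knotMatrix (fun i' => X i' c.1) k i c.2 with hKdef
    have hdesign : design X hk = Matrix.fromCols (Ptilde X k hk) (centering n * K) := by
      rw [design, Matrix.mul_fromCols]
      rfl
    have hMP : centering n * Ptilde X k hk = Ptilde X k hk := by
      rw [Ptilde, ← Matrix.mul_assoc, centering_mul_centering]
    have hrP : r ᵥ* Ptilde X k hk = 0 := by
      ext c
      have := hr (Sum.inl c)
      rw [hdesign, Matrix.vecMul_fromCols] at this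
      exact abs_nonpos_iff.1 this
    obtain ⟨u, hu⟩ := (hU.2 (centering n *ᵥ r)).2 ⟨sum_centering_mulVec r, fun c => by
      have h1 : (centering n *ᵥ r) ᵥ* Ptilde X k hk = 0 := by
        rw [← hrP]
        conv_rhs => rw [← hMP, ← Matrix.vecMul_vecMul, vecMul_centering]
      have h2 := congrFun h1 c
      simpa [Matrix.vecMul, dotProduct, mul_comm] using h2⟩
    have huK : u ᵥ* Ktilde X k U = r ᵥ* (centering n * K) := by
      rw [Ktilde, ← hKdef, Matrix.mul_assoc, ← Matrix.vecMul_vecMul, Matrix.vecMul_transpose, hu]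
      conv_rhs => rw [← centering_mul_centering, Matrix.mul_assoc, ← Matrix.vecMul_vecMul,
        vecMul_centering]
    have hUP : Uᵀ * Ptilde X k hk = 0 := by
      ext e c
      have := ((hU.2 (U.col e)).1 ⟨Pi.single e 1, by simp⟩).2 c
      simpa [Matrix.mul_apply, mul_comm] using this
    have hsplit : Ptilde X k hk *ᵥ (b ∘ Sum.inl) + (centering n * K) *ᵥ (b ∘ Sum.inr) = 0 := by
      rw [← h0, hdesign, Matrix.fromCols_mulVec]
    have hα0 : Ktilde X k U *ᵥ (b ∘ Sum.inr) = 0 := by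
      have := congrArg (Uᵀ *ᵥ ·) hsplit
      simpa [Matrix.mulVec_add, hUP, Ktilde, ← Matrix.mul_assoc, hKdef] using this
    have hα : b ∘ Sum.inr = 0 := by
      refine eq_zero_of_linearIndepOn
        (hK.linearIndepOn u (Λ := lam * k.factorial) (by positivity)) (fun c hc => ?_) hα0
      refine hb (Sum.inr c) fun hmem => hc ?_
      have hmem : |(r ᵥ* design X hk) (Sum.inr c)| = lam * k.factorial := hmem
      rw [hdesign, Matrix.vecMul_fromCols] at hmem
      change |(u ᵥ* Ktilde X k U) c| = _
      rw [huK]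
      exact hmem
    have ha : b ∘ Sum.inl = 0 := by
      rw [hα, Matrix.mulVec_zero, add_zero] at hsplit
      exact Matrix.mulVec_injective_iff.2 hP (by rw [hsplit, Matrix.mulVec_zero])
    ext (c | c)
    · exact congrFun ha c
    · exact congrFun hα c

/-- Once all polynomial coefficients are nonzero, the nonzero coefficients are the polynomial ones
and one for each knot. -/
lemma ncard_ne_zero_eq (hX : ∀ j, Function.Injective fun i => X i j)
    {b : (Fin d × Fin k) ⊕ (Fin d × Fin (n - (k + 1))) → ℝ} (hb : ∀ c, b (Sum.inl c) ≠ 0) :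
    {c | b c ≠ 0}.ncard =
      ∑ j, numKnots (fun i => X i j) k (components X hk b j) + k * d := by
  classical
  have h : ∀ j, numKnots (fun i => X i j) k (components X hk b j) =
      ∑ l, if b (Sum.inr (j, l)) ≠ 0 then 1 else 0 := by
    intro j
    have h1 : ∀ l, discreteDeriv (fun i => X i j) k (components X hk b j) l ≠ 0 ↔
        b (Sum.inr (j, l)) ≠ 0 := by
      intro l
      have h2 : discreteDeriv (fun i => X i j) k (components X hk b j) l =
        k.factorial * b (Sum.inr (j, l)) := discreteDeriv_component hk (hX j) _ _ l
      rw [h2]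
      simp [Nat.factorial_ne_zero]
    simp only [numKnots, h1]
    rw [← Finset.card_filter, ← Set.ncard_coe_finset]
    simp
  have hcard : {c | b c ≠ 0}.ncard = ∑ c, if b c ≠ 0 then 1 else 0 := by
    rw [← Finset.card_filter, ← Set.ncard_coe_finset]
    simp
  simp only [h]
  rw [hcard, Fintype.sum_sum_type,
    Fintype.sum_prod_type (fun c => if b (Sum.inr c) ≠ 0 then 1 else 0),
    add_comm]
  congr 1
  simp [hb, mul_comm]

end Additive

end AdditiveTF

theorem lemma3 {Ω : Type*} [MeasurableSpace Ω] (μ : Measure Ω) [IsProbabilityMeasure μ]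
    (n d k : ℕ) (hk : k < n)
    (X : Matrix (Fin n) (Fin d) ℝ) (hX : ∀ j, Function.Injective fun i => X i j)
    (hP : LinearIndependent ℝ (AdditiveTF.Ptilde X k hk).col)
    (U : Matrix (Fin n) (Fin (n - k * d - 1)) ℝ)
    (hU : AdditiveTF.IsOrthonormalComplement (AdditiveTF.Ptilde X k hk) U)
    (hK : AdditiveTF.GeneralPosition (AdditiveTF.Ktilde X k U))
    (lam : ℝ) (hlam : 0 ≤ lam) (hlam' : 2 ≤ d → 0 < lam)
    (η : Fin n → ℝ) (σ : ℝ) (hσ : 0 < σ)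
    (Y : Ω → Fin n → ℝ)
    (hY : HasLaw Y (Measure.pi fun i => gaussianReal (η i) (Real.toNNReal (σ ^ 2))) μ) :
    (∀ y : Fin n → ℝ, ∃! θ, AdditiveTF.IsSolution X k lam y θ) ∧
    ∀ θhat : (Fin n → ℝ) → Fin d → Fin n → ℝ,
      (∀ y, AdditiveTF.IsSolution X k lam y (θhat y)) →
      (∀ i, MemLp (fun ω => ∑ j, θhat (Y ω) j i) 2 μ) ∧
      Integrable (fun ω =>
        ∑ j, (AdditiveTF.numKnots (fun i => X i j) k (θhat (Y ω) j) : ℝ)) μ ∧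
      AdditiveTF.degreesOfFreedom μ Y σ (fun y i => ∑ j, θhat y j i) =
        (∫ ω, ∑ j, (AdditiveTF.numKnots (fun i => X i j) k (θhat (Y ω) j) : ℝ) ∂μ) + k * d := by
  have hW := AdditiveTF.nondegenerate_design X hk hX hP hU hK hlam hlam'
  have hiff := AdditiveTF.isSolution_iff X hk hX hlam
  constructor
  · intro y
    obtain ⟨b, hb⟩ := hW.exists_forall_lassoObj_le (AdditiveTF.weight_nonneg hlam) y
    have hst := AdditiveTF.stationary_of_forall_lassoObj_le (AdditiveTF.weight_nonneg hlam) hb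
    refine ⟨AdditiveTF.components X hk b, (hiff _ _).2 ⟨b, rfl, hst⟩, fun θ hθ => ?_⟩
    obtain ⟨b', rfl, hb'⟩ := (hiff _ _).1 hθ
    rw [hW.stationary_unique hb' hst]
  intro θhat hθ
  choose b hbθ hb using fun y => (hiff y (θhat y)).1 (hθ y)
  have hfit : ∀ y i, ∑ j, θhat y j i = (AdditiveTF.design X hk).mulVec (b y) i := by
    intro y i
    rw [AdditiveTF.design_mulVec, hbθ]
  have hv : Real.toNNReal (σ ^ 2) ≠ 0 := by
    rw [Ne, Real.toNNReal_eq_zero, not_le]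
    positivity
  have hvσ : ((Real.toNNReal (σ ^ 2) : NNReal) : ℝ) = σ ^ 2 := Real.coe_toNNReal _ (sq_nonneg _)
  have hae := AdditiveTF.ae_fit_eventuallyEq hW hb
  obtain ⟨hcont, hmem, hint, hcov⟩ := AdditiveTF.sum_covariance_pi_gaussianReal (η := η) hv
    (g := fun y => (AdditiveTF.design X hk).mulVec (b y))
    (N := fun y => ({c | b y c ≠ 0}.ncard : ℝ))
    (fun y y' => by simpa using (hb y).nonexpansive (hb y')) (hae.mono fun y hy => hy.1)
  have hmap := hY.map_eq
  have hknots : ∀ᵐ ω ∂μ, ({c | b (Y ω) c ≠ 0}.ncard : ℝ) =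
      ∑ j, (AdditiveTF.numKnots (fun i => X i j) k (θhat (Y ω) j) : ℝ) + k * d := by
    have h := (AdditiveTF.pi_gaussianReal_absolutelyContinuous (η := η) hv).ae_le hae
    rw [← hmap] at h
    filter_upwards [ae_of_ae_map hY.aemeasurable h] with ω hω
    rw [AdditiveTF.ncard_ne_zero_eq X hk hX fun c => hω.2 (Sum.inl c) rfl, hbθ]
    push_cast
    rfl
  have hintY : Integrable (fun ω => ({c | b (Y ω) c ≠ 0}.ncard : ℝ)) μ := by
    have h := hint
    rw [← hmap] at h
    exact h.comp_aemeasurable hY.aemeasurable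
  have hintK : Integrable (fun ω =>
      ∑ j, (AdditiveTF.numKnots (fun i => X i j) k (θhat (Y ω) j) : ℝ)) μ := by
    refine (hintY.sub (integrable_const ((k : ℝ) * d))).congr ?_
    filter_upwards [hknots] with ω hω
    simp only [Pi.sub_apply]
    rw [hω, add_sub_cancel_right]
  refine ⟨fun i => ?_, hintK, ?_⟩
  · simp only [hfit]
    have h := hmem i
    rw [← hmap] at h
    exact h.comp_of_map hY.aemeasurable
  · have hcovY : ∀ i, covariance (fun ω => ∑ j, θhat (Y ω) j i) (fun ω => Y ω i) μ =
        covariance (fun y => (AdditiveTF.design X hk).mulVec (b y) i) (fun y => y i)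
          (Measure.pi fun i => gaussianReal (η i) (Real.toNNReal (σ ^ 2))) := by
      intro i
      simp only [hfit]
      exact hY.covariance_fun_comp (f := fun y => (AdditiveTF.design X hk).mulVec (b y) i)
        (g := fun y => y i) (hcont i).aemeasurable (measurable_pi_apply i).aemeasurable
    have hN : ∫ ω, ({c | b (Y ω) c ≠ 0}.ncard : ℝ) ∂μ = _ :=
      hY.integral_comp hint.aestronglyMeasurable
    unfold AdditiveTF.degreesOfFreedom
    simp only [hcovY]
    rw [hcov, hvσ, ← hN, integral_congr_ae hknots, integral_add hintK (integrable_const _)]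
    simp only [integral_const, probReal_univ, one_smul]
    field_simp
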